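/- Let $\mathfrak g=V_1\oplus V_2$ be a finite-dimensional real Lie algebra with a step-two stratification, i.e. $[V_1,V_1]=V_2\neq\{0\}$ and $[V_2,V_1]=\{0\}$, with $\dim V_1=r$ and $\dim V_2=\frac{r(r-1)}2-2$. Let $G$ be the associated Carnot group (connected, simply connected, with Lie algebra $\mathfrak g$), identified with $\mathfrak g$ by the exponential map, so that $\exp X\cdot\exp Y=\exp(X+Y+\frac12[X,Y])$ and $\dim G=\frac{r^2+r}2-2$. For $u\in L^2([0,1],V_1)$ let $\gamma_u:[0,1]\to G$ be the absolutely continuous curve with $\gamma_u(0)=e$ and $\dot\gamma_u(t)=(\mathrm dL_{\gamma_u(t)})_e u(t)$ for a.e. $t$, where $L_g$ is left translation by $g$; let $\mathrm{End}(u):=\gamma_u(1)$ be the endpoint map, and let $$\mathrm{Abn}_G:=\{\gamma_u(1)\,:\,u\in L^2([0,1],V_1),\ \mathrm{Im}(\mathrm d\,\mathrm{End}_u)\subsetneq T_{\gamma_u(1)}G\}$$ be the abnormal set. Then $\mathrm{Abn}_G$ has codimension at least $3$ in $G$, i.e. $$\dim \mathrm{Abn}_G\le \tfrac{r^2+r}2-5=\dim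 G-3 .$$ Here the dimension bound holds in both of the following senses: the Hausdorff dimension of $\mathrm{Abn}_G$ with respect to a norm on $G\cong\mathfrak g$ is at most $\frac{r^2+r}2-5$, and $\mathrm{Abn}_G$ is contained in a real affine algebraic subvariety of $G\cong\mathfrak g$ (the common zero set of an ideal $I$ of real polynomials on $\mathfrak g$) of dimension (Krull dimension of $\mathbb R[\mathfrak g]/I$) at most $\frac{r^2+r}2-5$. -/

import Mathlib

open MeasureTheory Set

/-- A Lie ring with a norm compatible with its additive structure. -/
class NormedLieRing (𝔤 : Type*) extends NormedAddCommGroup 𝔤, LieRing 𝔤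

/-- A real Lie algebra with an auxiliary norm. On a finite-dimensional Lie algebra such a norm
always exists and any two of them are equivalent; it serves only to name the Euclidean topology,
the derivatives and the Hausdorff dimension. No compatibility with the bracket is required. -/
class NormedRealLieAlgebra (𝔤 : Type*) [NormedLieRing 𝔤] extends
  LieAlgebra ℝ 𝔤, NormedSpace ℝ 𝔤

section Algebra

variable {𝔤 : Type*} [NormedLieRing 𝔤] [NormedRealLieAlgebra 𝔤]

/-- `[A, B]`: the linear span of all brackets `⁅x, y⁆` with `x ∈ A`, `y ∈ B`. -/
def bracketSpan (A B : Submodule ℝ 𝔤) : Submodule ℝ 𝔤 :=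
  Submodule.span ℝ {z | ∃ x ∈ A, ∃ y ∈ B, ⁅x, y⁆ = z}

/-- `𝔤 = V₁ ⊕ V₂` is a stratification of step two. -/
structure IsStepTwoStratification (V₁ V₂ : Submodule ℝ 𝔤) : Prop where
  isCompl : IsCompl V₁ V₂
  generates : bracketSpan V₁ V₁ = V₂
  ne_bot : V₂ ≠ ⊥
  central : bracketSpan V₂ V₁ = ⊥

theorem IsStepTwoStratification.exists_add {V₁ V₂ : Submodule ℝ 𝔤}
    (h : IsStepTwoStratification V₁ V₂) (x : 𝔤) : ∃ a ∈ V₁, ∃ b ∈ V₂, a + b = x := by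
  have : x ∈ V₁ ⊔ V₂ := by rw [h.isCompl.sup_eq_top]; trivial
  exact Submodule.mem_sup.1 this

theorem IsStepTwoStratification.lie_mem {V₁ V₂ : Submodule ℝ 𝔤}
    (h : IsStepTwoStratification V₁ V₂) {x y : 𝔤} (hx : x ∈ V₁) (hy : y ∈ V₁) :
    ⁅x, y⁆ ∈ V₂ := by
  rw [← h.generates]
  exact Submodule.subset_span ⟨x, hx, y, hy, rfl⟩

theorem IsStepTwoStratification.lie_eq_zero_of_mem {V₁ V₂ : Submodule ℝ 𝔤}
    (h : IsStepTwoStratification V₁ V₂) {z x : 𝔤} (hz : z ∈ V₂) (hx : x ∈ V₁) :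
    ⁅z, x⁆ = 0 := by
  have : ⁅z, x⁆ ∈ bracketSpan V₂ V₁ := Submodule.subset_span ⟨z, hz, x, hx, rfl⟩
  rw [h.central] at this
  simpa using this

theorem IsStepTwoStratification.lie_central {V₁ V₂ : Submodule ℝ 𝔤}
    (h : IsStepTwoStratification V₁ V₂) {z : 𝔤} (hz : z ∈ V₂) (x : 𝔤) : ⁅z, x⁆ = 0 := by
  have key : ∀ w ∈ V₂, ⁅z, w⁆ = 0 := by
    intro w hw
    rw [← h.generates] at hw
    induction hw using Submodule.span_induction with
    | mem w hw =>
      obtain ⟨a, ha, b, hb, rfl⟩ := hw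
      rw [leibniz_lie, h.lie_eq_zero_of_mem hz ha, h.lie_eq_zero_of_mem hz hb]
      simp
    | zero => simp
    | add a b _ _ ha hb => rw [lie_add, ha, hb, add_zero]
    | smul c a _ ha => rw [lie_smul, ha, smul_zero]
  obtain ⟨a, ha, b, hb, rfl⟩ := h.exists_add x
  rw [lie_add, h.lie_eq_zero_of_mem hz ha, key b hb, add_zero]

theorem IsStepTwoStratification.lie_mem' {V₁ V₂ : Submodule ℝ 𝔤}
    (h : IsStepTwoStratification V₁ V₂) (x y : 𝔤) : ⁅x, y⁆ ∈ V₂ := by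
  obtain ⟨a, ha, b, hb, rfl⟩ := h.exists_add x
  obtain ⟨c, hc, d, hd, rfl⟩ := h.exists_add y
  have h1 : ⁅a, d⁆ = 0 := by rw [← lie_skew, h.lie_central hd, neg_zero]
  rw [add_lie, h.lie_central hb, lie_add, h1, add_zero, add_zero]
  exact h.lie_mem ha hc

theorem IsStepTwoStratification.lie_lie_eq_zero {V₁ V₂ : Submodule ℝ 𝔤}
    (h : IsStepTwoStratification V₁ V₂) (x y z : 𝔤) : ⁅⁅x, y⁆, z⁆ = 0 :=
  h.lie_central (h.lie_mem' x y) z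

end Algebra

/-- The Carnot group associated with a step-two stratified Lie algebra `𝔤 = V₁ ⊕ V₂`, in
exponential coordinates: the underlying manifold is the vector space `𝔤`, the exponential map is
the identity, and the product is given by the Baker–Campbell–Hausdorff formula. -/
def CarnotGroup {𝔤 : Type*} [NormedLieRing 𝔤] [NormedRealLieAlgebra 𝔤]
    {V₁ V₂ : Submodule ℝ 𝔤} (_h : IsStepTwoStratification V₁ V₂) : Type _ := 𝔤

namespace CarnotGroup

variable {𝔤 : Type*} [NormedLieRing 𝔤] [NormedRealLieAlgebra 𝔤]
  {V₁ V₂ : Submodule ℝ 𝔤} (h : IsStepTwoStratification V₁ V₂)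

/-- The exponential coordinates as a global chart: the linear structure of `𝔤`. -/
instance : NormedAddCommGroup (CarnotGroup h) := inferInstanceAs (NormedAddCommGroup 𝔤)

instance : NormedSpace ℝ (CarnotGroup h) := inferInstanceAs (NormedSpace ℝ 𝔤)

/-- The exponential map `exp : 𝔤 → G`, with inverse `log`. -/
def exp : 𝔤 ≃L[ℝ] CarnotGroup h := ContinuousLinearEquiv.refl ℝ 𝔤

/-- `exp X * exp Y = exp (X + Y + [X, Y] / 2)`. -/
noncomputable instance : Mul (CarnotGroup h) where
  mul g g' := exp h ((exp h).symm g + (exp h).symm g' +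
    (2⁻¹ : ℝ) • ⁅(exp h).symm g, (exp h).symm g'⁆)

instance : One (CarnotGroup h) := ⟨exp h 0⟩

instance : Inv (CarnotGroup h) := ⟨fun g => exp h (-(exp h).symm g)⟩

theorem exp_mul_exp (x y : 𝔤) :
    exp h x * exp h y = exp h (x + y + (2⁻¹ : ℝ) • ⁅x, y⁆) := rfl

theorem one_eq : (1 : CarnotGroup h) = exp h 0 := rfl

theorem inv_exp (x : 𝔤) : (exp h x)⁻¹ = exp h (-x) := rfl

noncomputable instance : Group (CarnotGroup h) :=
  Group.ofLeftAxioms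
    (by
      intro a b c
      obtain ⟨x, rfl⟩ := (exp h).surjective a
      obtain ⟨y, rfl⟩ := (exp h).surjective b
      obtain ⟨z, rfl⟩ := (exp h).surjective c
      simp only [exp_mul_exp]
      congr 1
      have h1 : ∀ u v w : 𝔤, ⁅u, ⁅v, w⁆⁆ = 0 := fun u v w => by
        rw [← lie_skew, h.lie_lie_eq_zero, neg_zero]
      simp only [add_lie, lie_add, smul_lie, lie_smul, h.lie_lie_eq_zero, h1, smul_zero,
        add_zero, smul_add]
      abel)
    (by
      intro a
      obtain ⟨x, rfl⟩ := (exp h).surjective a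
      rw [one_eq, exp_mul_exp]
      simp)
    (by
      intro a
      obtain ⟨x, rfl⟩ := (exp h).surjective a
      rw [one_eq, inv_exp, exp_mul_exp]
      simp)

/-- `(dL_g)_e : 𝔤 → T_g G`, the differential at the identity of the left translation by `g`
(with `𝔤` identified with `T_e G` by the differential of `exp` at `0`). -/
noncomputable def leftDiff (g : CarnotGroup h) : 𝔤 →L[ℝ] CarnotGroup h :=
  fderiv ℝ (fun X : 𝔤 => g * exp h X) 0

/-- The space `L²([0,1], V₁)` of controls. -/
abbrev Control (_h : IsStepTwoStratification V₁ V₂) : Type _ :=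
  Lp V₁ 2 ((volume : Measure ℝ).restrict (Icc 0 1))

/-- `γ` is (on `[0,1]`) the horizontal curve with control `u` that starts at the identity: an
absolutely continuous curve with `γ(0) = e` and `γ'(t) = (dL_{γ(t)})_e u(t)` for a.e. `t`. -/
structure IsTrajectory (u : Control h) (γ : ℝ → CarnotGroup h) : Prop where
  init : γ 0 = 1
  absCont : AbsolutelyContinuousOnInterval γ 0 1
  deriv : ∀ᵐ t ∂(volume.restrict (Icc (0 : ℝ) 1)),
    HasDerivAt γ (leftDiff h (γ t) (u t : 𝔤)) t


theorem control_intervalIntegrable (u : Control h) :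
    IntervalIntegrable (fun t => (u t : 𝔤)) volume 0 1 := by
  have h1 : Integrable u (volume.restrict (Icc (0 : ℝ) 1)) :=
    (Lp.memLp u).integrable (by norm_num)
  have h2 := V₁.subtypeL.integrable_comp h1
  rw [intervalIntegrable_iff_integrableOn_Icc_of_le zero_le_one]
  exact h2

section FiniteDimensional

variable [FiniteDimensional ℝ 𝔤]

/-- The bracket as a continuous bilinear map. -/
noncomputable def lieCLM (𝔤 : Type*) [NormedLieRing 𝔤] [NormedRealLieAlgebra 𝔤]
    [FiniteDimensional ℝ 𝔤] : 𝔤 →L[ℝ] 𝔤 →L[ℝ] 𝔤 :=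
  LinearMap.toContinuousLinearMap
    ((LinearMap.toContinuousLinearMap (𝕜 := ℝ) (E := 𝔤) (F' := 𝔤)).toLinearMap ∘ₗ
      LinearMap.mk₂ ℝ (fun x y : 𝔤 => ⁅x, y⁆) add_lie (fun c x y => smul_lie c x y) lie_add
        (fun c x y => lie_smul c x y))

theorem lieCLM_apply (x y : 𝔤) : lieCLM 𝔤 x y = ⁅x, y⁆ := rfl

theorem leftDiff_apply (x X : 𝔤) :
    leftDiff h (exp h x) X = exp h (X + (2⁻¹ : ℝ) • ⁅x, X⁆) := by
  have h1 : HasFDerivAt (fun Y : 𝔤 => x + Y + (2⁻¹ : ℝ) • lieCLM 𝔤 x Y)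
      (ContinuousLinearMap.id ℝ 𝔤 + (2⁻¹ : ℝ) • lieCLM 𝔤 x) 0 :=
    ((hasFDerivAt_id (0 : 𝔤)).const_add x).add ((lieCLM 𝔤 x).hasFDerivAt.const_smul _)
  have h2 := (exp h).toContinuousLinearMap.hasFDerivAt.comp (0 : 𝔤) h1
  have h3 : (fun Y : 𝔤 => exp h x * exp h Y) =
      (exp h).toContinuousLinearMap ∘ (fun Y : 𝔤 => x + Y + (2⁻¹ : ℝ) • lieCLM 𝔤 x Y) := rfl
  rw [leftDiff, h3, h2.fderiv]
  rfl

theorem absCont_integral {E : Type*} [NormedAddCommGroup E] [NormedSpace ℝ E]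
    {f : ℝ → E} {a b : ℝ} (hf : IntervalIntegrable f volume a b) :
    AbsolutelyContinuousOnInterval (fun x => ∫ t in a..x, f t) a b := by
  have hn := hf.norm.absolutelyContinuousOnInterval_intervalIntegral
    (c := a) left_mem_uIcc
  refine squeeze_zero' (Filter.Eventually.of_forall fun E =>
    Finset.sum_nonneg fun _ _ => dist_nonneg) ?_ hn
  refine Filter.mem_inf_of_right ?_
  rintro ⟨n, I⟩ hI
  change (∑ i ∈ Finset.range n, dist (∫ t in a..(I i).1, f t) (∫ t in a..(I i).2, f t)) ≤
    ∑ i ∈ Finset.range n, dist (∫ t in a..(I i).1, ‖f t‖) (∫ t in a..(I i).2, ‖f t‖)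
  refine Finset.sum_le_sum fun i hi => ?_
  obtain ⟨h1, h2⟩ := hI.1 i hi
  have i1 : IntervalIntegrable f volume a (I i).1 :=
    hf.mono_set (uIcc_subset_uIcc left_mem_uIcc h1)
  have i2 : IntervalIntegrable f volume a (I i).2 :=
    hf.mono_set (uIcc_subset_uIcc left_mem_uIcc h2)
  simp only [dist_eq_norm]
  rw [intervalIntegral.integral_interval_sub_left i1 i2,
    intervalIntegral.integral_interval_sub_left i1.norm i2.norm, Real.norm_eq_abs]
  exact intervalIntegral.norm_integral_le_abs_integral_norm

theorem absCont_comp_clm {E F : Type*} [NormedAddCommGroup E] [NormedSpace ℝ E]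
    [NormedAddCommGroup F] [NormedSpace ℝ F] (L : E →L[ℝ] F)
    {f : ℝ → E} {a b : ℝ} (hf : AbsolutelyContinuousOnInterval f a b) :
    AbsolutelyContinuousOnInterval (fun x => L (f x)) a b := by
  have h0 := Filter.Tendsto.const_mul ‖L‖ hf
  rw [mul_zero] at h0
  refine squeeze_zero (fun E => Finset.sum_nonneg fun _ _ => dist_nonneg) (fun E => ?_) h0
  rw [Finset.mul_sum]
  refine Finset.sum_le_sum fun i _ => ?_
  rw [dist_eq_norm, dist_eq_norm, ← map_sub]
  exact L.le_opNorm _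

theorem exists_isTrajectory (u : Control h) : ∃ γ, IsTrajectory h u γ := by
  have hu := control_intervalIntegrable h u
  set x : ℝ → 𝔤 := fun t => ∫ s in (0 : ℝ)..t, (u s : 𝔤) with hx
  have hxac : AbsolutelyContinuousOnInterval x 0 1 := absCont_integral hu
  set f : ℝ → 𝔤 := fun s => (2⁻¹ : ℝ) • lieCLM 𝔤 (x s) (u s : 𝔤) with hf
  have hfi : IntervalIntegrable f volume 0 1 := by
    refine IntervalIntegrable.smul ?_ _
    have hc : ContinuousOn (fun s => lieCLM 𝔤 (x s)) (uIcc 0 1) :=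
      (lieCLM 𝔤).continuous.comp_continuousOn hxac.continuousOn
    rw [intervalIntegrable_iff_integrableOn_Icc_of_le zero_le_one] at hu ⊢
    rw [uIcc_of_le zero_le_one] at hc
    obtain ⟨C, hC⟩ := isCompact_Icc.exists_bound_of_continuousOn hc
    refine Integrable.mono' (hu.norm.const_mul C) ?_ ?_
    · have hm := hc.aestronglyMeasurable measurableSet_Icc (μ := volume)
      exact (ContinuousLinearMap.apply ℝ 𝔤).flip.aestronglyMeasurable_comp₂ hm hu.1
    · refine (ae_restrict_iff' measurableSet_Icc).2 (Filter.Eventually.of_forall fun t ht => ?_)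
      exact ((lieCLM 𝔤 (x t)).le_opNorm _).trans
        (mul_le_mul_of_nonneg_right (hC t ht) (norm_nonneg _))
  have hzero : ∀ t ∈ Icc (0 : ℝ) 1, ∀ v : 𝔤, ⁅∫ s in (0 : ℝ)..t, f s, v⁆ = 0 := by
    intro t ht v
    have hsub : uIcc 0 t ⊆ uIcc (0 : ℝ) 1 :=
      uIcc_subset_uIcc left_mem_uIcc (by rwa [uIcc_of_le zero_le_one])
    have h1 := ((lieCLM 𝔤).flip v).intervalIntegral_comp_comm (hfi.mono_set hsub)
    have h2 : ∀ s, (lieCLM 𝔤).flip v (f s) = 0 := by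
      intro s
      simp only [ContinuousLinearMap.flip_apply, lieCLM_apply, hf, smul_lie,
        h.lie_lie_eq_zero, smul_zero]
    simp only [h2, intervalIntegral.integral_zero] at h1
    exact h1.symm
  refine ⟨fun t => exp h (x t + ∫ s in (0 : ℝ)..t, f s), ?_, ?_, ?_⟩
  · simp [hx, one_eq]
  · exact absCont_comp_clm (exp h).toContinuousLinearMap (hxac.add (absCont_integral hfi))
  · rw [ae_restrict_iff' measurableSet_Icc]
    filter_upwards [hu.ae_hasDerivAt_integral, hfi.ae_hasDerivAt_integral] with t h1 h2 ht
    have ht' : t ∈ uIcc (0 : ℝ) 1 := by rwa [uIcc_of_le zero_le_one]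
    have h3 := (h1 ht' 0 left_mem_uIcc).add (h2 ht' 0 left_mem_uIcc)
    rw [leftDiff_apply, add_lie, hzero t ht, add_zero]
    change HasDerivAt (fun t => x t + ∫ s in (0 : ℝ)..t, f s)
      ((u t : 𝔤) + (2⁻¹ : ℝ) • ⁅x t, (u t : 𝔤)⁆) t at h3
    exact (exp h).toContinuousLinearMap.hasFDerivAt.comp_hasDerivAt t h3

theorem IsTrajectory.eqOn {u : Control h} {γ γ' : ℝ → CarnotGroup h}
    (hγ : IsTrajectory h u γ) (hγ' : IsTrajectory h u γ') : EqOn γ γ' (Icc 0 1) := by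
  set δ : ℝ → 𝔤 := fun t => (exp h).symm (γ t - γ' t) with hδ
  have hac : AbsolutelyContinuousOnInterval δ 0 1 :=
    absCont_comp_clm (exp h).symm.toContinuousLinearMap (hγ.absCont.sub hγ'.absCont)
  have hd : ∀ᵐ t, t ∈ uIcc (0 : ℝ) 1 →
      HasDerivAt δ ((2⁻¹ : ℝ) • ⁅δ t, (u t : 𝔤)⁆) t := by
    have h1 := hγ.deriv
    have h2 := hγ'.deriv
    rw [ae_restrict_iff' measurableSet_Icc] at h1 h2
    filter_upwards [h1, h2] with t h1 h2 ht
    rw [uIcc_of_le zero_le_one] at ht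
    have h3 := (exp h).symm.toContinuousLinearMap.hasFDerivAt.comp_hasDerivAt t
      ((h1 ht).sub (h2 ht))
    refine h3.congr_deriv ?_
    obtain ⟨x, hx⟩ := (exp h).surjective (γ t)
    obtain ⟨y, hy⟩ := (exp h).surjective (γ' t)
    simp only [hδ, ← hx, ← hy, leftDiff_apply, ← map_sub]
    simp [sub_lie, smul_sub]
  have h0 : δ 0 = 0 := by simp [hδ, hγ.init, hγ'.init]
  set P : 𝔤 →L[ℝ] 𝔤 := LinearMap.toContinuousLinearMap (V₁.projection V₂ h.isCompl) with hP
  have hP0 : ∀ z, P z = 0 ↔ z ∈ V₂ := fun z => V₁.projection_apply_eq_zero_iff h.isCompl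
  have hPac := absCont_comp_clm P hac
  have hPd : ∀ᵐ t, t ∈ uIcc (0 : ℝ) 1 → HasDerivAt (fun t => P (δ t)) 0 t := by
    filter_upwards [hd] with t h1 ht
    refine (P.hasFDerivAt.comp_hasDerivAt t (h1 ht)).congr_deriv ?_
    exact (hP0 _).2 (V₂.smul_mem _ (h.lie_mem' _ _))
  obtain ⟨c, hc⟩ := hPac.const_of_ae_hasDerivAt_zero hPd
  have hV : ∀ t ∈ uIcc (0 : ℝ) 1, δ t ∈ V₂ := by
    intro t ht
    rw [← hP0, hc t ht, ← hc 0 left_mem_uIcc, h0, map_zero]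
  have hd0 : ∀ᵐ t, t ∈ uIcc (0 : ℝ) 1 → HasDerivAt δ 0 t := by
    filter_upwards [hd] with t h1 ht
    refine (h1 ht).congr_deriv ?_
    rw [h.lie_central (hV t ht), smul_zero]
  obtain ⟨c', hc'⟩ := hac.const_of_ae_hasDerivAt_zero hd0
  intro t ht
  rw [← uIcc_of_le zero_le_one] at ht
  have h1 : (exp h).symm (γ t - γ' t) = 0 := by
    have h2 := hc' t ht
    rwa [← hc' 0 left_mem_uIcc, h0] at h2
  exact sub_eq_zero.1 ((exp h).symm.map_eq_zero_iff.1 h1)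

/-- The horizontal curve `γ_u` with control `u` that starts at the identity; it is unique on
`[0,1]`. -/
noncomputable def trajectory (u : Control h) : ℝ → CarnotGroup h :=
  Classical.choose (exists_isTrajectory h u)

theorem trajectory_spec (u : Control h) : IsTrajectory h u (trajectory h u) :=
  Classical.choose_spec (exists_isTrajectory h u)

/-- The endpoint map `L²([0,1], V₁) → G`, `u ↦ γ_u(1)`. -/
noncomputable def endpoint (u : Control h) : CarnotGroup h := trajectory h u 1

/-- The curve `γ_u` is abnormal: the image of the differential at `u` of the endpoint map is a
proper subspace of the tangent space. -/
def IsAbnormal (u : Control h) : Prop :=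
  LinearMap.range (fderiv ℝ (endpoint h) u : Control h →ₗ[ℝ] CarnotGroup h) ≠ ⊤

/-- The abnormal set: the endpoints of the abnormal curves that start at the identity. -/
def abnormalSet : Set (CarnotGroup h) := {g | ∃ u, IsAbnormal h u ∧ endpoint h u = g}

end FiniteDimensional

end CarnotGroup

/-- The set `A` in the real vector space `E` is contained in a real affine algebraic subvariety of
dimension at most `d`: in all linear coordinates, it lies in the zero locus of an ideal of
polynomials whose quotient ring has Krull dimension at most `d`. -/
def IsContainedInSubvariety {E : Type*} [AddCommGroup E] [Module ℝ E] (A : Set E) (d : ℕ) : Prop :=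
  ∀ (n : ℕ) (b : Module.Basis (Fin n) ℝ E), ∃ I : Ideal (MvPolynomial (Fin n) ℝ),
    b.equivFun '' A ⊆ MvPolynomial.zeroLocus ℝ I ∧
      ringKrullDim (MvPolynomial (Fin n) ℝ ⧸ I) ≤ d

/-! Let `x(t)` be the primitive of the control `u`. Since `V₂` is central, the endpoint is `exp
(x(1) + ½ ∫ [x, u])`, and its differential sends `v` to `∫ (v + [x(s) - ½ x(1), v(s)]) ds`. A
covector `φ ≠ 0` killing the image therefore vanishes on `V₁`, and `x(t)` stays in the radical of
the form `φ [·, ·]` on `V₁` (`IsAbnormal.exists_covector`).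

By the dimension hypothesis the brackets of a basis of `V₁` satisfy two independent linear
relations. Each relation is an alternating form `w j` on the covectors of `V₁`. Let `Ω` be the
matrix of `φ [·, ·]`; its row space annihilates the radical and has dimension at least two. It
contains a plane isotropic for `w 0` and `w 1` (`exists_isotropic_rows`): in rank two the row space
itself is such a plane, because `φ` kills the relations; in rank at least four one fixes `a ≠ 0` and
solves two linear equations for `b`. Hence the curve ends in `W + [W, W]`, where `W ⊆ V₁` is the
codimension-two common kernel of an isotropic plane.

With `m = r - 2`, planes depend on `2m` parameters. Isotropy for two independent forms costs two of
them (`ratCov_isotropic`), and a point of `W + [W, W]` needs at most `m + m(m-1)/2` more. The total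
`3m - 2 + m(m-1)/2` equals `dim G - 3`.

Parameters are counted by `RatCov`, covering by finitely many rational images. Such a cover bounds
the Hausdorff dimension, since these maps are locally Lipschitz off their poles, and the Krull
dimension of a containing variety, through transcendence degree. One count thus yields both
conclusions. -/

/-! ### Polynomial functions -/

/-- A real function on `ℝ^κ` given by a polynomial. -/
def IsPolyFun {κ : Type*} (f : (κ → ℝ) → ℝ) : Prop :=
  ∃ P : MvPolynomial κ ℝ, ∀ x, f x = MvPolynomial.eval x P

namespace IsPolyFun

variable {κ ρ : Type*} {f g : (κ → ℝ) → ℝ}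

theorem const (c : ℝ) : IsPolyFun (fun _ : κ → ℝ => c) := ⟨MvPolynomial.C c, by simp⟩

theorem coord (k : κ) : IsPolyFun (fun x : κ → ℝ => x k) := ⟨MvPolynomial.X k, by simp⟩

theorem add (hf : IsPolyFun f) (hg : IsPolyFun g) : IsPolyFun (fun x => f x + g x) := by
  obtain ⟨P, hP⟩ := hf
  obtain ⟨Q, hQ⟩ := hg
  exact ⟨P + Q, fun x => by simp [hP, hQ]⟩

theorem mul (hf : IsPolyFun f) (hg : IsPolyFun g) : IsPolyFun (fun x => f x * g x) := by
  obtain ⟨P, hP⟩ := hf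
  obtain ⟨Q, hQ⟩ := hg
  exact ⟨P * Q, fun x => by simp [hP, hQ]⟩

theorem neg (hf : IsPolyFun f) : IsPolyFun (fun x => -f x) := by
  obtain ⟨P, hP⟩ := hf
  exact ⟨-P, fun x => by simp [hP]⟩

theorem sub (hf : IsPolyFun f) (hg : IsPolyFun g) : IsPolyFun (fun x => f x - g x) := by
  obtain ⟨P, hP⟩ := hf
  obtain ⟨Q, hQ⟩ := hg
  exact ⟨P - Q, fun x => by simp [hP, hQ]⟩

theorem sum {ι : Type*} (s : Finset ι) {F : ι → (κ → ℝ) → ℝ} (hF : ∀ i, IsPolyFun (F i)) :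
    IsPolyFun (fun x => ∑ i ∈ s, F i x) := by
  choose P hP using hF
  exact ⟨∑ i ∈ s, P i, fun x => by simp [hP]⟩

theorem comp_rename (hf : IsPolyFun f) (σ : κ → ρ) : IsPolyFun (fun z : ρ → ℝ => f (z ∘ σ)) := by
  obtain ⟨P, hP⟩ := hf
  exact ⟨MvPolynomial.rename σ P, fun z => by simp [hP, MvPolynomial.eval_rename]⟩

end IsPolyFun

/-! ### Sets parametrized by rational maps -/

/-- `S` lies in the image of a rational map (with poles along a hypersurface) in at most `d`
variables. -/
def RatParam (d : ℕ) {κ : Type} (S : Set (κ → ℝ)) : Prop :=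
  ∃ (τ : Type) (_ : Fintype τ), Fintype.card τ ≤ d ∧
    ∃ (q : MvPolynomial τ ℝ) (N : κ → ℕ) (p : κ → MvPolynomial τ ℝ), ∀ y ∈ S, ∃ t : τ → ℝ,
      MvPolynomial.eval t q ≠ 0 ∧
        ∀ k, y k * MvPolynomial.eval t q ^ N k = MvPolynomial.eval t (p k)

/-- `S` is covered by finitely many images of rational maps in at most `d` variables. -/
def RatCov (d : ℕ) {κ : Type} (S : Set (κ → ℝ)) : Prop :=
  ∃ 𝒯 : Set (Set (κ → ℝ)), 𝒯.Finite ∧ S ⊆ ⋃₀ 𝒯 ∧ ∀ T ∈ 𝒯, RatParam d T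

section

variable {d d' : ℕ} {κ μ : Type} {S T : Set (κ → ℝ)}

theorem RatParam.mono (h : RatParam d S) (hd : d ≤ d') : RatParam d' S := by
  obtain ⟨τ, i, h1, h2⟩ := h
  exact ⟨τ, i, h1.trans hd, h2⟩

theorem RatParam.ratCov (h : RatParam d S) : RatCov d S :=
  ⟨{S}, finite_singleton S, by simp, by simpa using h⟩

namespace RatCov

theorem mono (h : RatCov d S) (hd : d ≤ d') : RatCov d' S := by
  obtain ⟨𝒯, h1, h2, h3⟩ := h
  exact ⟨𝒯, h1, h2, fun T hT => (h3 T hT).mono hd⟩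

theorem subset (h : RatCov d S) (hT : T ⊆ S) : RatCov d T := by
  obtain ⟨𝒯, h1, h2, h3⟩ := h
  exact ⟨𝒯, h1, hT.trans h2, h3⟩

theorem iUnion {ι : Type*} [Finite ι] {F : ι → Set (κ → ℝ)} (h : ∀ i, RatCov d (F i)) :
    RatCov d (⋃ i, F i) := by
  choose 𝒯 h1 h2 h3 using h
  refine ⟨⋃ i, 𝒯 i, finite_iUnion h1, ?_, ?_⟩
  · refine iUnion_subset fun i => (h2 i).trans (sUnion_mono (subset_iUnion _ i))
  · intro T hT
    obtain ⟨i, hi⟩ := mem_iUnion.1 hT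
    exact h3 i T hi

theorem union (h : RatCov d S) (h' : RatCov d T) : RatCov d (S ∪ T) := by
  rw [union_eq_iUnion]
  exact iUnion fun b => by cases b <;> assumption

end RatCov

theorem ratCov_univ [Fintype κ] : RatCov (Fintype.card κ) (univ : Set (κ → ℝ)) :=
  RatParam.ratCov ⟨κ, inferInstance, le_rfl, 1, 0, MvPolynomial.X, fun y _ => ⟨y, by simp⟩⟩

theorem ratCov_singleton (x : κ → ℝ) : RatCov 0 {x} :=
  RatParam.ratCov ⟨Empty, inferInstance, by simp, 1, 0, fun k => MvPolynomial.C (x k),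
    fun y hy => ⟨0, by simp [mem_singleton_iff.1 hy]⟩⟩

/-- Substituting fractions with denominator a power of `q` into a polynomial. -/
theorem IsPolyFun.subst_fraction {τ ρ : Type*} {f : (κ ⊕ ρ → ℝ) → ℝ} (hf : IsPolyFun f)
    (q : MvPolynomial τ ℝ) (N : κ → ℕ) (p : κ → MvPolynomial τ ℝ) :
    ∃ (M : ℕ) (P : MvPolynomial (τ ⊕ ρ) ℝ), ∀ (t : τ → ℝ) (c : ρ → ℝ) (x : κ → ℝ),
      (∀ k, x k * MvPolynomial.eval t q ^ N k = MvPolynomial.eval t (p k)) →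
        f (Sum.elim x c) * MvPolynomial.eval t q ^ M = MvPolynomial.eval (Sum.elim t c) P := by
  have hq : ∀ (R : MvPolynomial τ ℝ) (t : τ → ℝ) (c : ρ → ℝ),
      MvPolynomial.eval (Sum.elim t c) (MvPolynomial.rename Sum.inl R) =
        MvPolynomial.eval t R := by
    intro R t c
    rw [MvPolynomial.eval_rename]
    rfl
  obtain ⟨F, hF⟩ := hf
  simp only [hF]
  clear hF
  induction F using MvPolynomial.induction_on with
  | C a => exact ⟨0, MvPolynomial.C a, by simp⟩
  | add F G hF hG =>
    obtain ⟨M, P, h⟩ := hF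
    obtain ⟨M', P', h'⟩ := hG
    refine ⟨M + M', P * MvPolynomial.rename Sum.inl (q ^ M') +
      P' * MvPolynomial.rename Sum.inl (q ^ M), fun t c x hx => ?_⟩
    simp only [map_add, map_mul, hq, ← h t c x hx, ← h' t c x hx, map_pow]
    ring
  | mul_X F i hF =>
    obtain ⟨M, P, h⟩ := hF
    rcases i with k | j
    · refine ⟨M + N k, P * MvPolynomial.rename Sum.inl (p k), fun t c x hx => ?_⟩
      simp only [map_mul, hq, ← h t c x hx, ← hx k, MvPolynomial.eval_X, Sum.elim_inl]
      ring
    · refine ⟨M, P * MvPolynomial.X (Sum.inr j), fun t c x hx => ?_⟩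
      simp only [map_mul, ← h t c x hx, MvPolynomial.eval_X, Sum.elim_inr]
      ring

/-- The basic counting rule: each new free variable `c` costs one parameter, while every `y m`
solved for as a fraction `F m / D` costs nothing. -/
theorem RatParam.image {ρ : Type} [Fintype ρ] (h : RatParam d S) {D : (κ ⊕ ρ → ℝ) → ℝ}
    {F : μ → (κ ⊕ ρ → ℝ) → ℝ} (hD : IsPolyFun D) (hF : ∀ m, IsPolyFun (F m)) :
    RatParam (d + Fintype.card ρ) {y : μ → ℝ | ∃ x ∈ S, ∃ c : ρ → ℝ,
      D (Sum.elim x c) ≠ 0 ∧ ∀ m, y m * D (Sum.elim x c) = F m (Sum.elim x c)} := by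
  obtain ⟨τ, _, hτ, q, N, p, hp⟩ := h
  obtain ⟨M, P, hP⟩ := hD.subst_fraction q N p
  choose M' P' hP' using fun m => (hF m).subst_fraction q N p
  have hq : ∀ (R : MvPolynomial τ ℝ) (t : τ → ℝ) (c : ρ → ℝ),
      MvPolynomial.eval (Sum.elim t c) (MvPolynomial.rename Sum.inl R) =
        MvPolynomial.eval t R := by
    intro R t c
    rw [MvPolynomial.eval_rename]
    rfl
  -- The new denominator is `q * P`, where `P = D * q ^ M` after substitution; it is nonzero exactly
  -- when both the old denominator and `D` are.
  refine ⟨τ ⊕ ρ, inferInstance, by simpa using hτ, MvPolynomial.rename Sum.inl q * P,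
    fun m => M' m + 1, fun m => P' m * MvPolynomial.rename Sum.inl (q ^ (M + 1)) * P ^ (M' m),
    ?_⟩
  rintro y ⟨x, hx, c, hDc, hy⟩
  obtain ⟨t, ht, htx⟩ := hp x hx
  refine ⟨Sum.elim t c, ?_, fun m => ?_⟩
  · rw [map_mul, hq, ← hP t c x htx]
    exact mul_ne_zero ht (mul_ne_zero hDc (pow_ne_zero _ ht))
  · simp only [map_mul, map_pow, hq, ← hP t c x htx, ← hP' m t c x htx, ← hy m]
    ring

theorem RatCov.image {ρ : Type} [Fintype ρ] (h : RatCov d S) {D : (κ ⊕ ρ → ℝ) → ℝ}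
    {F : μ → (κ ⊕ ρ → ℝ) → ℝ} (hD : IsPolyFun D) (hF : ∀ m, IsPolyFun (F m)) :
    RatCov (d + Fintype.card ρ) {y : μ → ℝ | ∃ x ∈ S, ∃ c : ρ → ℝ,
      D (Sum.elim x c) ≠ 0 ∧ ∀ m, y m * D (Sum.elim x c) = F m (Sum.elim x c)} := by
  obtain ⟨𝒯, h1, h2, h3⟩ := h
  have h4 := h1.to_subtype
  refine (RatCov.iUnion fun T : 𝒯 => ((h3 T T.2).image hD hF).ratCov).subset ?_
  rintro y ⟨x, hx, hxy⟩
  obtain ⟨T, hT, hxT⟩ := h2 hx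
  exact mem_iUnion.2 ⟨⟨T, hT⟩, x, hxT, hxy⟩

theorem RatCov.polyImage {ρ : Type} [Fintype ρ] (h : RatCov d S)
    {F : μ → (κ ⊕ ρ → ℝ) → ℝ} (hF : ∀ m, IsPolyFun (F m)) :
    RatCov (d + Fintype.card ρ)
      {y : μ → ℝ | ∃ x ∈ S, ∃ c : ρ → ℝ, ∀ m, y m = F m (Sum.elim x c)} := by
  refine (h.image (IsPolyFun.const 1) hF).subset ?_
  rintro y ⟨x, hx, c, hy⟩
  exact ⟨x, hx, c, one_ne_zero, by simpa using hy⟩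

theorem RatCov.rename {ν : Type} (σ : ν → κ) (h : RatCov d S) :
    RatCov d {y : ν → ℝ | ∃ x ∈ S, y = x ∘ σ} := by
  refine (h.polyImage (ρ := Empty) (F := fun m z => z (Sum.inl (σ m)))
    fun m => IsPolyFun.coord _).subset ?_
  rintro y ⟨x, hx, rfl⟩
  exact ⟨x, hx, 0, fun m => rfl⟩

theorem RatCov.prod_univ {lam : Type} [Fintype lam] (h : RatCov d S) :
    RatCov (d + Fintype.card lam) {z : κ ⊕ lam → ℝ | z ∘ Sum.inl ∈ S} := by
  refine (h.polyImage (ρ := lam) (F := fun m z => z m) fun m => IsPolyFun.coord _).subset ?_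
  intro z hz
  exact ⟨_, hz, z ∘ Sum.inr, fun m => by rw [Sum.elim_comp_inl_inr]⟩

/-- A family of affine hyperplanes of `ℝ^lam` over `S`. -/
theorem RatCov.fiber_one {lam : Type} [Fintype lam] [DecidableEq lam] (h : RatCov d S)
    {G : (κ → ℝ) → ℝ} {L : lam → (κ → ℝ) → ℝ} (hG : IsPolyFun G) (hL : ∀ l, IsPolyFun (L l))
    (i : lam) :
    RatCov (d + Fintype.card lam - 1) {z : κ ⊕ lam → ℝ | z ∘ Sum.inl ∈ S ∧
      G (z ∘ Sum.inl) + ∑ l, z (Sum.inr l) * L l (z ∘ Sum.inl) = 0 ∧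
        L i (z ∘ Sum.inl) ≠ 0} := by
  set ρ := {l : lam // l ≠ i}
  have hρ : Fintype.card ρ = Fintype.card lam - 1 := by
    rw [Fintype.card_subtype_compl, Fintype.card_subtype_eq]
  have hG' := hG.comp_rename (Sum.inl : κ → κ ⊕ ρ)
  have hL' := fun l => (hL l).comp_rename (Sum.inl : κ → κ ⊕ ρ)
  have hlam : 0 < Fintype.card lam := Fintype.card_pos_iff.2 ⟨i⟩
  rw [show d + Fintype.card lam - 1 = d + Fintype.card ρ by omega]
  -- The variable of index `i` is solved for, with denominator `L i`; the others stay free.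
  refine (h.image (ρ := ρ) (D := fun z => L i (z ∘ Sum.inl))
    (F := fun m z => Sum.elim (fun k => z (Sum.inl k) * L i (z ∘ Sum.inl))
      (fun l => if hl : l = i then -(G (z ∘ Sum.inl) +
          ∑ l : ρ, z (Sum.inr l) * L l (z ∘ Sum.inl))
        else z (Sum.inr ⟨l, hl⟩) * L i (z ∘ Sum.inl)) m) (hL' i) ?_).subset ?_
  · rintro (k | l)
    · exact (IsPolyFun.coord _).mul (hL' i)
    · by_cases hl : l = i
      · simp only [Sum.elim_inr, hl, dite_true]
        exact (hG'.add (IsPolyFun.sum Finset.univ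
          fun l : ρ => (IsPolyFun.coord (Sum.inr l)).mul (hL' l))).neg
      · simp only [Sum.elim_inr, hl, dite_false]
        exact (IsPolyFun.coord _).mul (hL' i)
  · rintro z ⟨hz, h1, h2⟩
    refine ⟨_, hz, fun l => z (Sum.inr l), ?_, ?_⟩
    · simpa using h2
    · rintro (k | l)
      · simp
      · by_cases hl : l = i
        · subst hl
          rw [Fintype.sum_eq_add_sum_subtype_ne _ l] at h1
          simp only [Sum.elim_inr, dite_true, Sum.elim_comp_inl]
          linarith
        · simp [hl]

theorem card_ne_and_ne {lam : Type*} [Fintype lam] [DecidableEq lam] {i k : lam} (hik : i ≠ k) :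
    Fintype.card {l : lam // l ≠ i ∧ l ≠ k} + 2 = Fintype.card lam := by
  have : Fintype.card {l : lam // l ≠ i ∧ l ≠ k} = ((Finset.univ : Finset lam) \ {i, k}).card := by
    rw [Fintype.card_subtype]
    congr 1
    ext l
    simp
  have h2 : 1 < Fintype.card lam := Fintype.one_lt_card_iff.2 ⟨i, k, hik⟩
  rw [this, Finset.card_sdiff_of_subset (Finset.subset_univ _), Finset.card_pair hik,
    Finset.card_univ]
  omega

theorem sum_eq_add_add_sum_ne_and_ne {lam M : Type*} [Fintype lam] [DecidableEq lam]
    [AddCommMonoid M] {i k : lam} (hik : i ≠ k) (f : lam → M) :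
    ∑ l, f l = f i + f k + ∑ l : {l : lam // l ≠ i ∧ l ≠ k}, f l := by
  rw [← Finset.sum_add_sum_compl {i, k}, Finset.sum_pair hik]
  congr 1
  rw [← Finset.sum_subtype]
  intro l
  simp

/-- A family of affine subspaces of codimension two of `ℝ^lam` over `S`. -/
theorem RatCov.fiber_two {lam : Type} [Fintype lam] [DecidableEq lam] (h : RatCov d S)
    {G G' : (κ → ℝ) → ℝ} {L L' : lam → (κ → ℝ) → ℝ} (hG : IsPolyFun G) (hG' : IsPolyFun G')
    (hL : ∀ l, IsPolyFun (L l)) (hL' : ∀ l, IsPolyFun (L' l)) (i k : lam) :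
    RatCov (d + Fintype.card lam - 2) {z : κ ⊕ lam → ℝ | z ∘ Sum.inl ∈ S ∧
      G (z ∘ Sum.inl) + ∑ l, z (Sum.inr l) * L l (z ∘ Sum.inl) = 0 ∧
      G' (z ∘ Sum.inl) + ∑ l, z (Sum.inr l) * L' l (z ∘ Sum.inl) = 0 ∧
      L i (z ∘ Sum.inl) * L' k (z ∘ Sum.inl) - L k (z ∘ Sum.inl) * L' i (z ∘ Sum.inl) ≠ 0} := by
  -- For `i = k` the minor vanishes identically, so the set is empty.
  rcases eq_or_ne i k with rfl | hik
  · refine ⟨∅, finite_empty, ?_, by simp⟩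
    rintro z ⟨-, -, -, h4⟩
    exact absurd (by ring) h4
  set ρ := {l : lam // l ≠ i ∧ l ≠ k}
  have hρ : Fintype.card ρ + 2 = Fintype.card lam := card_ne_and_ne hik
  have pG := hG.comp_rename (Sum.inl : κ → κ ⊕ ρ)
  have pG' := hG'.comp_rename (Sum.inl : κ → κ ⊕ ρ)
  have pL := fun l => (hL l).comp_rename (Sum.inl : κ → κ ⊕ ρ)
  have pL' := fun l => (hL' l).comp_rename (Sum.inl : κ → κ ⊕ ρ)
  set D : (κ ⊕ ρ → ℝ) → ℝ := fun z =>
    L i (z ∘ Sum.inl) * L' k (z ∘ Sum.inl) - L k (z ∘ Sum.inl) * L' i (z ∘ Sum.inl) with hD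
  set A : (κ ⊕ ρ → ℝ) → ℝ := fun z =>
    G (z ∘ Sum.inl) + ∑ l : ρ, z (Sum.inr l) * L l (z ∘ Sum.inl) with hA
  set A' : (κ ⊕ ρ → ℝ) → ℝ := fun z =>
    G' (z ∘ Sum.inl) + ∑ l : ρ, z (Sum.inr l) * L' l (z ∘ Sum.inl) with hA'
  have pD : IsPolyFun D := ((pL i).mul (pL' k)).sub ((pL k).mul (pL' i))
  have pA : IsPolyFun A :=
    pG.add (IsPolyFun.sum _ fun l => (IsPolyFun.coord _).mul (pL l))
  have pA' : IsPolyFun A' :=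
    pG'.add (IsPolyFun.sum _ fun l => (IsPolyFun.coord _).mul (pL' l))
  rw [show d + Fintype.card lam - 2 = d + Fintype.card ρ by omega]
  -- Cramer's rule for the variables `i` and `k`, with the nonzero minor `D` as denominator.
  refine (h.image (ρ := ρ) (D := D)
    (F := fun m z => Sum.elim (fun k => z (Sum.inl k) * D z)
      (fun l => if hl : l = i then -(A z * L' k (z ∘ Sum.inl) - A' z * L k (z ∘ Sum.inl))
        else if hl' : l = k then -(A' z * L i (z ∘ Sum.inl) - A z * L' i (z ∘ Sum.inl))
        else z (Sum.inr ⟨l, hl, hl'⟩) * D z) m) pD ?_).subset ?_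
  · rintro (m | l)
    · exact (IsPolyFun.coord _).mul pD
    · by_cases hl : l = i
      · simp only [Sum.elim_inr, hl, dite_true]
        exact ((pA.mul (pL' k)).sub (pA'.mul (pL k))).neg
      · by_cases hl' : l = k
        · simp only [Sum.elim_inr, hl', hik.symm, dite_true, dite_false]
          exact ((pA'.mul (pL i)).sub (pA.mul (pL' i))).neg
        · simp only [Sum.elim_inr, hl, hl', dite_false]
          exact (IsPolyFun.coord _).mul pD
  · rintro z ⟨hz, h1, h2, h3⟩
    refine ⟨_, hz, fun l => z (Sum.inr l), ?_, ?_⟩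
    · simpa [hD] using h3
    · rw [sum_eq_add_add_sum_ne_and_ne hik] at h1 h2
      rintro (m | l)
      · simp
      · by_cases hl : l = i
        · subst hl
          simp only [Sum.elim_inr, dite_true, Sum.elim_comp_inl, hD, hA, hA']
          linear_combination L' k (z ∘ Sum.inl) * h1 - L k (z ∘ Sum.inl) * h2
        · by_cases hl' : l = k
          · subst hl'
            simp only [Sum.elim_inr, hik.symm, dite_true, dite_false, Sum.elim_comp_inl, hD,
              hA, hA']
            linear_combination L i (z ∘ Sum.inl) * h2 - L' i (z ∘ Sum.inl) * h1
          · simp [hl, hl', hD]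

end

/-! ### Krull and Hausdorff dimension of parametrized sets -/

/-- Incomparability: contracting primes along an integral map preserves strict inclusions. -/
theorem ringKrullDim_le_of_isIntegral {R A : Type*} [CommRing R] [CommRing A] (f : R →+* A)
    (hf : f.IsIntegral) : ringKrullDim A ≤ ringKrullDim R := by
  algebraize [f]
  refine Order.krullDim_le_of_strictMono
    (fun I : PrimeSpectrum A => (⟨I.asIdeal.comap (algebraMap R A), inferInstance⟩ :
      PrimeSpectrum R)) ?_
  intro I J hIJ
  exact Ideal.IsIntegral.comap_lt_comap (R := R) (A := A) hIJ

/-- A subalgebra of finite type of an algebra of transcendence degree `≤ d` over a field has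
Krull dimension `≤ d`. -/
theorem ringKrullDim_le_of_injective_of_trdeg_le {k B A : Type} [Field k] [CommRing B] [Algebra k B]
    [Algebra.FiniteType k B] [Nontrivial B] [CommRing A] [Algebra k A] {d : ℕ}
    (f : B →ₐ[k] A) (hf : Function.Injective f) (hd : Algebra.trdeg k A ≤ d) :
    ringKrullDim B ≤ d := by
  -- Noether normalization: `B` is integral over a polynomial ring in `s` variables, and these stay
  -- algebraically independent in `A`, whence `s ≤ d`.
  obtain ⟨s, g, hg, hg'⟩ := exists_integral_inj_algHom_of_fg k B
  have h1 : ringKrullDim B ≤ s := by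
    refine (ringKrullDim_le_of_isIntegral g.toRingHom hg').trans ?_
    rw [MvPolynomial.ringKrullDim_of_isNoetherianRing, ringKrullDim_eq_zero_of_field]
    simp
  have h2 : (s : Cardinal.{0}) ≤ d := by
    have := (trdeg_le_of_injective (f.comp g) (hf.comp hg)).trans hd
    simpa using this
  exact h1.trans (by exact_mod_cast h2)

/-- The ideal is the kernel of the comorphism into the polynomial ring localized at `q`. Its
quotient embeds in that localization, which has transcendence degree at most `d`; evaluation at a
parameter `t` with `q(t) ≠ 0` factors through the localization. -/
theorem RatParam.exists_ideal {d : ℕ} {κ : Type} [Finite κ] {S : Set (κ → ℝ)}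
    (h : RatParam d S) : ∃ I : Ideal (MvPolynomial κ ℝ), S ⊆ MvPolynomial.zeroLocus ℝ I ∧
      ringKrullDim (MvPolynomial κ ℝ ⧸ I) ≤ d := by
  obtain ⟨τ, _, hτ, q, N, p, hp⟩ := h
  rcases eq_or_ne q 0 with rfl | hq
  · refine ⟨⊤, fun y hy => ?_, ?_⟩
    · obtain ⟨t, ht, -⟩ := hp y hy
      simp at ht
    · rw [ringKrullDim_eq_bot_of_subsingleton]
      exact bot_le
  set A := Localization.Away q
  have hpow : Submonoid.powers q ≤ nonZeroDivisors (MvPolynomial τ ℝ) :=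
    powers_le_nonZeroDivisors_of_noZeroDivisors hq
  have : IsDomain A := IsLocalization.isDomain_localization hpow
  have hinj : Function.Injective (algebraMap (MvPolynomial τ ℝ) A) :=
    IsLocalization.injective A hpow
  have : FaithfulSMul (MvPolynomial τ ℝ) A := (faithfulSMul_iff_algebraMap_injective _ _).2 hinj
  have halg : Algebra.IsAlgebraic (MvPolynomial τ ℝ) A :=
    IsLocalization.isAlgebraic _ (Submonoid.powers q)
  have htr : Algebra.trdeg ℝ A ≤ d := by
    rw [← trdeg_add_eq ℝ (MvPolynomial τ ℝ) (A := A), trdeg_eq_zero (R := MvPolynomial τ ℝ) (A := A), add_zero,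
      MvPolynomial.trdeg_of_isDomain]
    simpa using hτ
  set F : MvPolynomial κ ℝ →ₐ[ℝ] A := MvPolynomial.aeval fun k =>
    algebraMap _ A (p k) * IsLocalization.Away.invSelf q ^ N k with hF
  refine ⟨RingHom.ker F, ?_, ?_⟩
  · intro y hy
    obtain ⟨t, ht, hty⟩ := hp y hy
    rw [MvPolynomial.mem_zeroLocus_iff]
    intro P hP
    have hu : IsUnit (MvPolynomial.aeval t q : ℝ) := by
      rw [MvPolynomial.aeval_eq_eval]
      exact isUnit_iff_ne_zero.2 ht
    set ev : A →+* ℝ := IsLocalization.Away.lift (S := A) q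
      (g := (MvPolynomial.aeval t : MvPolynomial τ ℝ →ₐ[ℝ] ℝ).toRingHom) hu with hev
    have hev1 : ∀ R, ev (algebraMap _ A R) = MvPolynomial.eval t R := fun R => by
      rw [hev, IsLocalization.Away.lift_eq]
      simp
    have hinv : MvPolynomial.eval t q * ev (IsLocalization.Away.invSelf q) = 1 := by
      rw [← hev1, ← map_mul, IsLocalization.Away.mul_invSelf, map_one]
    have hcomp : ev.comp F.toRingHom = (MvPolynomial.aeval y : _ →ₐ[ℝ] ℝ).toRingHom := by
      refine MvPolynomial.ringHom_ext (fun r => ?_) fun k => ?_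
      · have : F (MvPolynomial.C r) =
            algebraMap (MvPolynomial τ ℝ) A (MvPolynomial.C r) := by
          rw [hF, MvPolynomial.aeval_C, IsScalarTower.algebraMap_apply ℝ (MvPolynomial τ ℝ) A]
          rfl
        simp [this, hev1]
      · have h1 : ev (F (MvPolynomial.X k)) = y k := by
          rw [hF, MvPolynomial.aeval_X, map_mul, hev1, ← hty k, map_pow, mul_assoc, ← mul_pow,
            hinv, one_pow, mul_one]
        simpa using h1
    have := congrArg (fun f : MvPolynomial κ ℝ →+* ℝ => f P) hcomp
    have hP0 : F P = 0 := hP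
    simpa [hP0] using this.symm
  · have : Nontrivial (MvPolynomial κ ℝ ⧸ RingHom.ker F) :=
      Ideal.Quotient.nontrivial_iff.2 (RingHom.ker_ne_top F)
    exact ringKrullDim_le_of_injective_of_trdeg_le (Ideal.kerLiftAlg F)
      (Ideal.kerLiftAlg_injective F) htr

/-- If the smallest prime of a chain contains `I ⊓ J`, it contains `I` or `J`, and so do all the
others. -/
theorem ringKrullDim_quotient_inf_le {R : Type*} [CommRing R] {I J : Ideal R}
    {d : WithBot ℕ∞} (hI : ringKrullDim (R ⧸ I) ≤ d) (hJ : ringKrullDim (R ⧸ J) ≤ d) :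
    ringKrullDim (R ⧸ (I ⊓ J)) ≤ d := by
  rw [ringKrullDim_quotient] at hI hJ ⊢
  refine iSup_le fun c => ?_
  have h0 : I ⊓ J ≤ (c 0).1.asIdeal := by
    have := (c 0).2
    rwa [PrimeSpectrum.mem_zeroLocus, SetLike.coe_subset_coe] at this
  have key : ∀ K : Ideal R, Order.krullDim (PrimeSpectrum.zeroLocus (R := R) K) ≤ d →
      K ≤ (c 0).1.asIdeal → (c.length : WithBot ℕ∞) ≤ d := by
    intro K hK hK0
    have hmem : ∀ i, (c i).1 ∈ PrimeSpectrum.zeroLocus (R := R) K := fun i => by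
      rw [PrimeSpectrum.mem_zeroLocus, SetLike.coe_subset_coe]
      exact hK0.trans (c.strictMono.monotone (Fin.zero_le i))
    refine le_trans ?_ hK
    exact le_iSup_of_le (⟨c.length, fun i => ⟨(c i).1, hmem i⟩, fun i => c.step i⟩ :
      LTSeries (PrimeSpectrum.zeroLocus (R := R) K)) le_rfl
  rcases (c 0).1.2.inf_le.1 h0 with h | h
  · exact key I hI h
  · exact key J hJ h

theorem RatCov.exists_ideal {d : ℕ} {κ : Type} [Finite κ] {S : Set (κ → ℝ)}
    (h : RatCov d S) : ∃ I : Ideal (MvPolynomial κ ℝ), S ⊆ MvPolynomial.zeroLocus ℝ I ∧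
      ringKrullDim (MvPolynomial κ ℝ ⧸ I) ≤ d := by
  obtain ⟨𝒯, h1, h2, h3⟩ := h
  suffices H : ∃ I : Ideal (MvPolynomial κ ℝ), ⋃₀ 𝒯 ⊆ MvPolynomial.zeroLocus ℝ I ∧
      ringKrullDim (MvPolynomial κ ℝ ⧸ I) ≤ d by
    obtain ⟨I, hI, hd⟩ := H
    exact ⟨I, h2.trans hI, hd⟩
  clear h2
  induction 𝒯, h1 using Set.Finite.induction_on with
  | empty =>
    refine ⟨⊤, by simp, ?_⟩
    rw [ringKrullDim_eq_bot_of_subsingleton]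
    exact bot_le
  | @insert T 𝒯 _ _ ih =>
    obtain ⟨I, hI, hId⟩ := ih fun T hT => h3 T (mem_insert_of_mem _ hT)
    obtain ⟨J, hJ, hJd⟩ := (h3 T (mem_insert _ _)).exists_ideal
    refine ⟨I ⊓ J, ?_, ringKrullDim_quotient_inf_le hId hJd⟩
    rw [sUnion_insert]
    exact union_subset (hJ.trans (MvPolynomial.zeroLocus_anti_mono inf_le_right))
      (hI.trans (MvPolynomial.zeroLocus_anti_mono inf_le_left))

theorem RatParam.dimH_le {d : ℕ} {κ : Type} [Fintype κ] {S : Set (κ → ℝ)}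
    (h : RatParam d S) : dimH S ≤ d := by
  obtain ⟨τ, _, hτ, q, N, p, hp⟩ := h
  set g : (τ → ℝ) → κ → ℝ := fun t k =>
    MvPolynomial.eval t (p k) / MvPolynomial.eval t q ^ N k with hg
  have hsm : ∀ P : MvPolynomial τ ℝ, ContDiff ℝ 1 fun t => MvPolynomial.eval t P := by
    intro P
    induction P using MvPolynomial.induction_on with
    | C a => simpa using contDiff_const
    | add P Q hP hQ => simpa using hP.add hQ
    | mul_X P i hP => simpa using hP.mul (contDiff_apply ℝ ℝ i)
  have hS : S ⊆ g '' {t | MvPolynomial.eval t q ≠ 0} := by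
    intro y hy
    obtain ⟨t, ht, hty⟩ := hp y hy
    refine ⟨t, ht, funext fun k => ?_⟩
    simp only [hg, ← hty k]
    exact mul_div_cancel_right₀ _ (pow_ne_zero _ ht)
  refine (dimH_mono hS).trans ?_
  refine (dimH_image_le_of_locally_lipschitzOn fun t ht => ?_).trans ?_
  · have hgt : ContDiffAt ℝ 1 g t := contDiffAt_pi.2 fun k =>
      (hsm (p k)).contDiffAt.div ((hsm q).contDiffAt.pow _) (pow_ne_zero _ ht)
    obtain ⟨C, s, hs, hC⟩ := hgt.exists_lipschitzOnWith
    exact ⟨C, s, mem_nhdsWithin_of_mem_nhds hs, hC⟩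
  · refine (dimH_mono (subset_univ _)).trans ?_
    rw [Real.dimH_univ_pi]
    exact_mod_cast hτ

theorem RatCov.dimH_le {d : ℕ} {κ : Type} [Fintype κ] {S : Set (κ → ℝ)}
    (h : RatCov d S) : dimH S ≤ d := by
  obtain ⟨𝒯, h1, h2, h3⟩ := h
  refine (dimH_mono h2).trans ?_
  rw [dimH_sUnion h1.countable]
  exact iSup₂_le fun T hT => (h3 T hT).dimH_le

/-! ### Planes isotropic for a pencil of alternating forms -/

section Chart

variable {U : Type*} [AddCommGroup U] [Module ℝ U] {J : Type} [Fintype J]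

/-- The point of the affine space `e + span z` with coordinates `x`. -/
def affinePoint (e : U) (z : J → U) (x : J → ℝ) : U := e + ∑ j, x j • z j

theorem bilin_affinePoint_left (B : LinearMap.BilinForm ℝ U) (e : U) (z : J → U) (x : J → ℝ)
    (y : U) : B (affinePoint e z x) y = B e y + ∑ j, x j * B (z j) y := by
  simp [affinePoint, LinearMap.sum_apply]

theorem bilin_affinePoint_right (B : LinearMap.BilinForm ℝ U) (e : U) (z : J → U) (x : J → ℝ)
    (y : U) : B y (affinePoint e z x) = B y e + ∑ j, x j * B y (z j) := by
  simp [affinePoint]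

theorem isPolyFun_bilin_affinePoint {κ : Type*} (B : LinearMap.BilinForm ℝ U) (e : U) (z : J → U)
    (ν : J → κ) (y : U) : IsPolyFun fun x : κ → ℝ => B (affinePoint e z (x ∘ ν)) y := by
  simp only [bilin_affinePoint_left]
  exact (IsPolyFun.const _).add
    (IsPolyFun.sum _ fun j => (IsPolyFun.coord (ν j)).mul (IsPolyFun.const _))

/-- The member with coordinates `s` of the pencil of bilinear forms spanned by `w 0` and `w 1`. -/
def pencil (w : Fin 2 → LinearMap.BilinForm ℝ U) (s : Fin 2 → ℝ) : LinearMap.BilinForm ℝ U :=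
  s 0 • w 0 + s 1 • w 1

theorem pencil_apply (w : Fin 2 → LinearMap.BilinForm ℝ U) (s : Fin 2 → ℝ) (x y : U) :
    pencil w s x y = s 0 * w 0 x y + s 1 * w 1 x y := by
  simp [pencil]

theorem pencil_isAlt {w : Fin 2 → LinearMap.BilinForm ℝ U} (hw : ∀ j, (w j).IsAlt)
    (s : Fin 2 → ℝ) : (pencil w s).IsAlt := fun x => by
  rw [pencil_apply, (hw 0).self_eq_zero, (hw 1).self_eq_zero]
  simp

theorem isPolyFun_pencil {κ : Type*} (w : Fin 2 → LinearMap.BilinForm ℝ U) (ν : Fin 2 → κ)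
    (x y : U) : IsPolyFun fun s : κ → ℝ => pencil w (s ∘ ν) x y := by
  simp only [pencil_apply]
  exact ((IsPolyFun.coord (ν 0)).mul (IsPolyFun.const _)).add
    ((IsPolyFun.coord (ν 1)).mul (IsPolyFun.const _))

theorem bilin_eq_zero_of_frame {ι : Type*} (P Q : U) (z : ι → U) {B : LinearMap.BilinForm ℝ U} (hB : B.IsAlt)
    (hspan : Submodule.span ℝ (insert P (insert Q (range z))) = ⊤) (hPQ : B P Q = 0)
    (hP : ∀ l, B P (z l) = 0) (hQ : ∀ l, B (z l) Q = 0) (hz : ∀ l m, B (z l) (z m) = 0) :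
    B = 0 := by
  have hsw : ∀ x y, B x y = 0 → B y x = 0 := fun x y hxy => by
    rw [← hB.neg_eq, hxy, neg_zero]
  refine LinearMap.ext_on hspan ?_
  intro x hx
  refine LinearMap.ext_on hspan ?_
  intro y hy
  simp only [LinearMap.zero_apply]
  rcases hx with rfl | rfl | ⟨l, rfl⟩ <;> rcases hy with rfl | rfl | ⟨m, rfl⟩
  · exact hB.self_eq_zero _
  · exact hPQ
  · exact hP m
  · exact hsw _ _ hPQ
  · exact hB.self_eq_zero _
  · exact hsw _ _ (hQ m)
  · exact hsw _ _ (hP l)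
  · exact hQ l
  · exact hz l m

/-- Write `a` and `b` for the two points. As `B a` kills the `z l`, the identities `B a a = 0` and
`B a b = 0` reduce to `B a P = 0` and `B a Q = 0`. -/
theorem bilin_affinePoint_eq_zero (P Q : U) (z : J → U) {B : LinearMap.BilinForm ℝ U} (hB : B.IsAlt)
    (hspan : Submodule.span ℝ (insert P (insert Q (range z))) = ⊤) {x y : J → ℝ}
    (h : B (affinePoint P z x) (affinePoint Q z y) = 0)
    (hz : ∀ l, B (affinePoint P z x) (z l) = 0) : B (affinePoint P z x) = 0 := by
  have h1 := hB.self_eq_zero (affinePoint P z x)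
  rw [bilin_affinePoint_right] at h h1
  simp only [hz, mul_zero, Finset.sum_const_zero, add_zero] at h h1
  refine LinearMap.ext_on hspan ?_
  rintro v (rfl | rfl | ⟨l, rfl⟩)
  · exact h1
  · exact h
  · exact hz l

variable [DecidableEq J] (w : Fin 2 → LinearMap.BilinForm ℝ U) (P Q : U) (z : J → U)

/-- For fixed first vector the two equations are affine in the second one, with independent linear
parts. -/
theorem ratCov_isotropic_of_minor_ne_zero (i k : J) :
    RatCov (Fintype.card J + Fintype.card J - 2) {x : J ⊕ J → ℝ |
      (∀ j, w j (affinePoint P z (x ∘ Sum.inl)) (affinePoint Q z (x ∘ Sum.inr)) = 0) ∧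
      w 0 (affinePoint P z (x ∘ Sum.inl)) (z i) * w 1 (affinePoint P z (x ∘ Sum.inl)) (z k) -
        w 0 (affinePoint P z (x ∘ Sum.inl)) (z k) * w 1 (affinePoint P z (x ∘ Sum.inl)) (z i)
        ≠ 0} := by
  refine ((ratCov_univ (κ := J)).fiber_two
    (isPolyFun_bilin_affinePoint (w 0) P z id Q) (isPolyFun_bilin_affinePoint (w 1) P z id Q)
    (fun l => isPolyFun_bilin_affinePoint (w 0) P z id (z l))
    (fun l => isPolyFun_bilin_affinePoint (w 1) P z id (z l)) i k).subset ?_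
  rintro x ⟨hx, hik⟩
  have h0 := hx 0
  have h1 := hx 1
  rw [bilin_affinePoint_right] at h0 h1
  exact ⟨mem_univ _, h0, h1, hik⟩

/-- The degenerate case in which both forms vanish on the span of `z`: isotropy is then affine in
both vectors jointly. The base is the one-point space `Empty → ℝ`. -/
theorem ratCov_isotropic_of_linear (i k : J ⊕ J) :
    RatCov (Fintype.card J + Fintype.card J - 2) {x : J ⊕ J → ℝ |
      (∀ j, w j P Q + ∑ l, x l * Sum.elim (fun l => w j (z l) Q) (fun l => w j P (z l)) l = 0) ∧
      (Sum.elim (fun l => w 0 (z l) Q) (fun l => w 0 P (z l)) i *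
        Sum.elim (fun l => w 1 (z l) Q) (fun l => w 1 P (z l)) k -
      Sum.elim (fun l => w 0 (z l) Q) (fun l => w 0 P (z l)) k *
        Sum.elim (fun l => w 1 (z l) Q) (fun l => w 1 P (z l)) i ≠ 0)} := by
  have h := ((ratCov_univ (κ := Empty)).fiber_two (lam := J ⊕ J)
    (IsPolyFun.const (w 0 P Q)) (IsPolyFun.const (w 1 P Q))
    (fun l => IsPolyFun.const (Sum.elim (fun l => w 0 (z l) Q) (fun l => w 0 P (z l)) l))
    (fun l => IsPolyFun.const (Sum.elim (fun l => w 1 (z l) Q) (fun l => w 1 P (z l)) l))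
    i k).rename Sum.inr
  rw [Fintype.card_empty, zero_add, Fintype.card_sum] at h
  refine h.subset ?_
  rintro x ⟨hx, hik⟩
  exact ⟨Sum.elim 0 x, ⟨mem_univ _, by simpa using hx 0, by simpa using hx 1, hik⟩,
    (Sum.elim_comp_inr _ _).symm⟩

/-- Here `ν` reads the coordinates of the first vector off the parameters `y`; the second vector
then lies in a proper hyperplane, which saves one parameter. -/
theorem RatCov.solve_right {κ : Type} {m : ℕ} {S : Set (κ → ℝ)} (h : RatCov m S) (ν : J → κ)
    (B : LinearMap.BilinForm ℝ U) (l : J) :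
    RatCov (m + Fintype.card J - 1) {x : J ⊕ J → ℝ | ∃ y ∈ S, x ∘ Sum.inl = y ∘ ν ∧
      B (affinePoint P z (x ∘ Sum.inl)) (affinePoint Q z (x ∘ Sum.inr)) = 0 ∧
      B (affinePoint P z (x ∘ Sum.inl)) (z l) ≠ 0} := by
  refine ((h.fiber_one (isPolyFun_bilin_affinePoint B P z ν Q)
    (fun l => isPolyFun_bilin_affinePoint B P z ν (z l)) l).rename
      (Sum.map ν (id : J → J))).subset ?_
  rintro x ⟨y, hy, hxy, h1, h2⟩
  rw [bilin_affinePoint_right] at h1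
  rw [hxy] at h1 h2
  refine ⟨Sum.elim y (x ∘ Sum.inr), ⟨hy, h1, h2⟩, ?_⟩
  rw [← Sum.elim_comp_inl_inr x, hxy]
  ext (j | j) <;> rfl

variable {w}

/-- Two linear conditions on the vector. Their minor at `i, k` is the square of `pencil (z i) (z
k)`, because the form is alternating. -/
theorem RatCov.pencil_two (hw : ∀ j, (w j).IsAlt) {κ : Type} {m : ℕ} {S : Set (κ → ℝ)}
    (h : RatCov m S) (ν : Fin 2 → κ) (i k : J) :
    RatCov (m + Fintype.card J - 2) {x : κ ⊕ J → ℝ | x ∘ Sum.inl ∈ S ∧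
      pencil w (x ∘ Sum.inl ∘ ν) (affinePoint P z (x ∘ Sum.inr)) (z i) = 0 ∧
      pencil w (x ∘ Sum.inl ∘ ν) (affinePoint P z (x ∘ Sum.inr)) (z k) = 0 ∧
      pencil w (x ∘ Sum.inl ∘ ν) (z i) (z k) ≠ 0} := by
  refine (h.fiber_two (isPolyFun_pencil w ν P (z i)) (isPolyFun_pencil w ν P (z k))
    (fun l => isPolyFun_pencil w ν (z l) (z i)) (fun l => isPolyFun_pencil w ν (z l) (z k))
    i k).subset ?_
  rintro x ⟨hx, h1, h2, h3⟩
  rw [bilin_affinePoint_left] at h1 h2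
  refine ⟨hx, h1, h2, ?_⟩
  have h4 := (pencil_isAlt hw (x ∘ Sum.inl ∘ ν)).neg_eq (z i) (z k)
  rw [← Function.comp_assoc] at h4
  rw [(pencil_isAlt hw _).self_eq_zero, ← h4]
  simpa [Function.comp_assoc] using h3

theorem ratCov_isotropic_of_kernel (hw : ∀ j, (w j).IsAlt) {m : ℕ} {S : Set (Fin 2 → ℝ)}
    (h : RatCov m S) (i k : J) :
    RatCov (m + Fintype.card J + Fintype.card J - 2) {x : J ⊕ J → ℝ | ∃ s ∈ S,
      pencil w s (affinePoint P z (x ∘ Sum.inl)) (z i) = 0 ∧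
      pencil w s (affinePoint P z (x ∘ Sum.inl)) (z k) = 0 ∧ pencil w s (z i) (z k) ≠ 0} := by
  refine (((h.prod_univ (lam := J)).pencil_two P z hw Sum.inl i k).rename
    (Sum.elim Sum.inr (Sum.inl ∘ Sum.inr))).subset ?_
  rintro x ⟨s, hs, h1, h2, h3⟩
  refine ⟨Sum.elim (Sum.elim s (x ∘ Sum.inr)) (x ∘ Sum.inl), ⟨hs, h1, h2, h3⟩, ?_⟩
  ext (j | j) <;> rfl

theorem ratCov_isotropic_of_pencil_two (hw : ∀ j, (w j).IsAlt) {m : ℕ} {S : Set (Fin 2 → ℝ)}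
    (h : RatCov m S) (i k l : J) (j : Fin 2) :
    RatCov (m + Fintype.card J - 2 + Fintype.card J - 1) {x : J ⊕ J → ℝ | ∃ s ∈ S,
      (pencil w s (affinePoint P z (x ∘ Sum.inl)) (z i) = 0 ∧
      pencil w s (affinePoint P z (x ∘ Sum.inl)) (z k) = 0 ∧ pencil w s (z i) (z k) ≠ 0) ∧
      w j (affinePoint P z (x ∘ Sum.inl)) (affinePoint Q z (x ∘ Sum.inr)) = 0 ∧
      w j (affinePoint P z (x ∘ Sum.inl)) (z l) ≠ 0} := by
  refine ((h.pencil_two P z hw id i k).solve_right P Q z Sum.inr (w j) l).subset ?_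
  rintro x ⟨s, hs, h1, h2⟩
  exact ⟨Sum.elim s (x ∘ Sum.inl), ⟨hs, h1⟩, rfl, h2⟩

theorem ratCov_isotropic_of_pencil_one {m : ℕ} {S : Set (Fin 2 → ℝ)}
    (h : RatCov m S) (i l : J) (j : Fin 2) :
    RatCov (m + Fintype.card J - 1 + Fintype.card J - 1) {x : J ⊕ J → ℝ | ∃ s ∈ S,
      (pencil w s (affinePoint P z (x ∘ Sum.inl)) Q = 0 ∧ pencil w s (z i) Q ≠ 0) ∧
      w j (affinePoint P z (x ∘ Sum.inl)) (affinePoint Q z (x ∘ Sum.inr)) = 0 ∧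
      w j (affinePoint P z (x ∘ Sum.inl)) (z l) ≠ 0} := by
  refine ((h.fiber_one (isPolyFun_pencil w id P Q) (fun l => isPolyFun_pencil w id (z l) Q)
    i).solve_right P Q z Sum.inr (w j) l).subset ?_
  rintro x ⟨s, hs, ⟨h1, h3⟩, h2⟩
  rw [bilin_affinePoint_left] at h1
  exact ⟨Sum.elim s (x ∘ Sum.inl), ⟨hs, h1, h3⟩, rfl, h2⟩

/-- The dependence is normalized to `(1 : *)` or `(0 : 1)`, so that members of the pencil cost one
parameter instead of two. -/
theorem exists_dependence_of_minors {ι : Type*} (f g : ι → ℝ)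
    (h : ∀ i k, f i * g k - f k * g i = 0) :
    ∃ s : Fin 2 → ℝ, (s 0 = 1 ∨ s = ![0, 1]) ∧ ∀ l, s 0 * f l + s 1 * g l = 0 := by
  by_cases hg : ∀ l, g l = 0
  · exact ⟨![0, 1], Or.inr rfl, fun l => by simp [hg]⟩
  · push Not at hg
    obtain ⟨i, hi⟩ := hg
    refine ⟨![1, -(f i / g i)], Or.inl rfl, fun l => ?_⟩
    have := h i l
    simp only [Matrix.cons_val_zero, Matrix.cons_val_one]
    field_simp
    linarith

theorem ratCov_pencil_parameters :
    RatCov 1 {s : Fin 2 → ℝ | s 0 = 1 ∨ s = ![0, 1]} := by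
  have h1 : RatCov 1 {s : Fin 2 → ℝ | s 0 = 1} := by
    have h := (ratCov_univ (κ := Empty)).polyImage (ρ := Unit)
      (F := fun m : Fin 2 => fun x => if m = 0 then 1 else x (Sum.inr ())) (fun m => by
        by_cases hm : m = 0
        · simpa [hm] using IsPolyFun.const 1
        · simpa [hm] using IsPolyFun.coord _)
    refine RatCov.subset (h.mono (by simp)) ?_
    intro s hs
    refine ⟨0, mem_univ _, fun _ => s 1, fun m => ?_⟩
    fin_cases m
    · simpa using hs
    · simp
  exact h1.union ((ratCov_singleton ![0, 1]).mono zero_le_one)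

/-- In an affine chart of the Grassmannian of planes, the planes isotropic for a pencil of
alternating forms form a set of codimension two. -/
theorem ratCov_isotropic (hw : ∀ j, (w j).IsAlt)
    (hspan : Submodule.span ℝ (insert P (insert Q (range z))) = ⊤)
    (hind : ∀ s, pencil w s = 0 → s = 0) :
    RatCov (Fintype.card J + Fintype.card J - 2) {x : J ⊕ J → ℝ |
      ∀ j, w j (affinePoint P z (x ∘ Sum.inl)) (affinePoint Q z (x ∘ Sum.inr)) = 0} := by
  have hne : ∀ s : Fin 2 → ℝ, (s 0 = 1 ∨ s = ![0, 1]) → s ≠ 0 := by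
    rintro s (hs | hs) rfl
    · simp at hs
    · simpa using congrFun hs 1
  -- If both forms vanish on the span of `z`, the equations are affine. If moreover all minors
  -- vanished at a solution, some member of the pencil would vanish on the whole frame, against
  -- independence.
  by_cases hZ : ∀ j l m, w j (z l) (z m) = 0
  · refine (RatCov.iUnion fun ik : (J ⊕ J) × (J ⊕ J) =>
      ratCov_isotropic_of_linear w P Q z ik.1 ik.2).subset ?_
    intro x hx
    have hx' : ∀ j, w j P Q +
        ∑ l, x l * Sum.elim (fun l => w j (z l) Q) (fun l => w j P (z l)) l = 0 := by
      intro j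
      have h := hx j
      rw [bilin_affinePoint_left, bilin_affinePoint_right] at h
      simp only [bilin_affinePoint_right, hZ, mul_zero, Finset.sum_const_zero, add_zero] at h
      rw [Fintype.sum_sum_type]
      simp only [Function.comp_apply] at h
      simp only [Sum.elim_inl, Sum.elim_inr]
      linarith
    by_contra hcon
    obtain ⟨s, hs, hsl⟩ := exists_dependence_of_minors
      (Sum.elim (fun l => w 0 (z l) Q) (fun l => w 0 P (z l)))
      (Sum.elim (fun l => w 1 (z l) Q) (fun l => w 1 P (z l))) (by
        intro i k
        by_contra h
        exact hcon (mem_iUnion.2 ⟨(i, k), hx', h⟩))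
    refine hne s hs (hind s (bilin_eq_zero_of_frame P Q z (pencil_isAlt hw s) hspan ?_
      (fun l => ?_) (fun l => ?_) fun l m => ?_))
    · have h0 := hx' 0
      have h1 := hx' 1
      have h2 : s 0 * ∑ l, x l * Sum.elim (fun l => w 0 (z l) Q) (fun l => w 0 P (z l)) l +
          s 1 * ∑ l, x l * Sum.elim (fun l => w 1 (z l) Q) (fun l => w 1 P (z l)) l = 0 := by
        rw [Finset.mul_sum, Finset.mul_sum, ← Finset.sum_add_distrib]
        refine Finset.sum_eq_zero fun l _ => ?_
        linear_combination x l * hsl l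
      rw [pencil_apply]
      linear_combination s 0 * h0 + s 1 * h1 - h2
    · rw [pencil_apply]
      exact hsl (Sum.inr l)
    · rw [pencil_apply]
      exact hsl (Sum.inl l)
    · rw [pencil_apply, hZ, hZ]
      simp
  · push Not at hZ
    obtain ⟨j₀, i₀, k₀, h₀⟩ := hZ
    have hlt : 1 < Fintype.card J := by
      refine Fintype.one_lt_card_iff.2 ⟨i₀, k₀, ?_⟩
      rintro rfl
      exact h₀ ((hw j₀).self_eq_zero _)
    -- At most two normalized members vanish on the span of `z`, since `w j₀` does not; choosing one
    -- costs no parameter.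
    set S₁ : Set (Fin 2 → ℝ) :=
      {s | (s 0 = 1 ∨ s = ![0, 1]) ∧ ∀ l m, pencil w s (z l) (z m) = 0} with hS₁
    have hS₁cov : RatCov 0 S₁ := by
      have hsub : {s : Fin 2 → ℝ | s 0 = 1 ∧ ∀ l m, pencil w s (z l) (z m) = 0}.Subsingleton := by
        rintro s ⟨hs, hsz⟩ t ⟨ht, htz⟩
        have e1 := hsz i₀ k₀
        have e2 := htz i₀ k₀
        rw [pencil_apply] at e1 e2
        rw [hs, one_mul] at e1
        rw [ht, one_mul] at e2
        have h1 : w 1 (z i₀) (z k₀) ≠ 0 := by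
          intro h1
          rw [h1, mul_zero, add_zero] at e1
          fin_cases j₀
          · exact h₀ e1
          · exact h₀ h1
        have h2 : s 1 = t 1 := mul_right_cancel₀ h1 (by linarith)
        ext m
        fin_cases m
        · exact hs.trans ht.symm
        · exact h2
      have h1 : RatCov 0 {s : Fin 2 → ℝ | s 0 = 1 ∧ ∀ l m, pencil w s (z l) (z m) = 0} := by
        rcases hsub.eq_empty_or_singleton with h | ⟨s, h⟩
        · rw [h]
          exact (ratCov_singleton 0).subset (empty_subset _)
        · rw [h]
          exact ratCov_singleton s
      refine (h1.union (ratCov_singleton ![0, 1])).subset ?_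
      rintro s ⟨hs | hs, h⟩
      · exact Or.inl ⟨hs, h⟩
      · exact Or.inr hs
    -- Four strata, by the functionals `w 0 a` and `w 1 a` and the parameter `s` of a normalized
    -- pencil member with `pencil w s a = 0`. In `c1` they are independent on `z`, and `b` loses two
    -- parameters. In `c2` both vanish, and `a` loses two. In `c3` and `c4` some `w j a` is nonzero,
    -- so `b` loses one. In `c3` the choice of `s` adds one parameter and `a` loses two; in `c4` `s`
    -- ranges over the finite set `S₁` and `a` loses one.
    have c1 := RatCov.iUnion fun ik : J × J =>
      ratCov_isotropic_of_minor_ne_zero w P Q z ik.1 ik.2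
    have c2 := ratCov_isotropic_of_kernel P z hw
      (ratCov_singleton (Pi.single j₀ (1 : ℝ))) i₀ k₀
    have c3 := RatCov.iUnion fun ik : (J × J) × (J × Fin 2) =>
      ratCov_isotropic_of_pencil_two P Q z hw ratCov_pencil_parameters ik.1.1 ik.1.2 ik.2.1 ik.2.2
    have c4 := RatCov.iUnion fun ik : J × (J × Fin 2) =>
      ratCov_isotropic_of_pencil_one (w := w) P Q z hS₁cov ik.1 ik.2.1 ik.2.2
    refine (((c1.union (c2.mono (by omega))).union (c3.mono (by omega))).union
      (c4.mono (by omega))).subset ?_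
    intro x hx
    by_contra hcon
    simp only [mem_union, mem_iUnion, not_or] at hcon
    obtain ⟨⟨⟨n1, n2⟩, n3⟩, n4⟩ := hcon
    set a := affinePoint P z (x ∘ Sum.inl) with ha
    set b := affinePoint Q z (x ∘ Sum.inr) with hb
    obtain ⟨s, hs, hsl⟩ := exists_dependence_of_minors (fun l => w 0 a (z l))
      (fun l => w 1 a (z l)) (by
        intro i k
        by_contra h
        exact n1 ⟨(i, k), hx, h⟩)
    have hsa : pencil w s a = 0 := by
      refine bilin_affinePoint_eq_zero P Q z (pencil_isAlt hw s) hspan (y := x ∘ Sum.inr) ?_ ?_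
      · rw [pencil_apply, hx 0, hx 1]
        simp
      · intro l
        rw [pencil_apply]
        exact hsl l
    by_cases hboth : ∀ j, w j a = 0
    · refine n2 ⟨Pi.single j₀ 1, rfl, ?_, ?_, ?_⟩
      · rw [pencil_apply, ← ha, hboth, hboth]
        simp
      · rw [pencil_apply, ← ha, hboth, hboth]
        simp
      · rw [pencil_apply]
        fin_cases j₀ <;> simpa using h₀
    · push Not at hboth
      obtain ⟨j, hj⟩ := hboth
      obtain ⟨l, hl⟩ : ∃ l, w j a (z l) ≠ 0 := by
        by_contra! h
        exact hj (bilin_affinePoint_eq_zero P Q z (hw j) hspan (hx j) h)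
      by_cases hsZ : ∀ l m, pencil w s (z l) (z m) = 0
      -- Otherwise `pencil w s a = 0` would force this member to vanish on the whole frame.
      · obtain ⟨i, hi⟩ : ∃ i, pencil w s (z i) Q ≠ 0 := by
          by_contra! h
          refine hne s hs (hind s (bilin_eq_zero_of_frame P Q z (pencil_isAlt hw s) hspan ?_
            (fun l => ?_) h hsZ))
          · have := congrArg (fun f => f Q) hsa
            simpa [ha, bilin_affinePoint_left, h] using this
          · have := congrArg (fun f => f (z l)) hsa
            simpa [ha, bilin_affinePoint_left, hsZ] using this
        exact n4 ⟨(i, l, j), s, ⟨hs, hsZ⟩, ⟨by rw [← ha, hsa]; rfl, hi⟩, hx j, hl⟩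
      · push Not at hsZ
        obtain ⟨i, k, hik⟩ := hsZ
        exact n3 ⟨((i, k), l, j), s, hs, ⟨by rw [← ha, hsa]; rfl, by rw [← ha, hsa]; rfl, hik⟩,
          hx j, hl⟩

end Chart

/-! ### Brackets of a basis and the forms attached to relations -/

/-- The increasing pairs of indices. -/
abbrev IncPairs (J : Type*) [LT J] : Type _ := {x : J × J // x.1 < x.2}

theorem two_mul_card_incPairs_add (J : Type*) [LinearOrder J] [Fintype J] :
    2 * Fintype.card (IncPairs J) + Fintype.card J = Fintype.card J * Fintype.card J := by
  have h1 : (Finset.univ.filter fun x : J × J => x.2 < x.1).card = Fintype.card (IncPairs J) := by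
    rw [Fintype.card_subtype]
    exact Finset.card_bij (fun x _ => x.swap) (by simp) (fun a _ b _ h => Prod.swap_injective h)
      (fun b hb => ⟨b.swap, by simpa using hb, by simp⟩)
  have h2 : (Finset.univ.filter fun x : J × J => x.1 = x.2).card = Fintype.card J := by
    rw [← Finset.card_univ]
    exact Finset.card_bij (fun x _ => x.1) (by simp)
      (fun a ha b hb h => by
        simp only [Finset.mem_filter, Finset.mem_univ, true_and] at ha hb
        exact Prod.ext h (by rw [← ha, ← hb, h]))
      (fun b _ => ⟨(b, b), by simp, rfl⟩)
  have h3 : Fintype.card (J × J) = Fintype.card (IncPairs J) +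
      (Finset.univ.filter fun x : J × J => x.2 < x.1).card +
      (Finset.univ.filter fun x : J × J => x.1 = x.2).card := by
    rw [Fintype.card_subtype, ← Finset.card_union_of_disjoint, ← Finset.card_union_of_disjoint,
      ← Finset.card_univ]
    · congr 1
      ext x
      simp only [Finset.mem_univ, Finset.mem_union, Finset.mem_filter, true_and, true_iff]
      rcases lt_trichotomy x.1 x.2 with h | h | h <;> simp [h]
    · rw [Finset.disjoint_left]
      intro x hx hx'
      simp only [Finset.mem_union, Finset.mem_filter, Finset.mem_univ, true_and] at hx hx'
      rcases hx with hx | hx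
      · exact hx.ne hx'
      · exact hx.ne' hx'
    · rw [Finset.disjoint_left]
      intro x hx hx'
      simp only [Finset.mem_filter, Finset.mem_univ, true_and] at hx hx'
      exact lt_asymm hx hx'
  rw [Fintype.card_prod, h1, h2] at h3
  omega

theorem exists_sum_of_mem_bracketSpan {𝔤 : Type*} [NormedLieRing 𝔤] [NormedRealLieAlgebra 𝔤]
    {J : Type*} [LinearOrder J] [Fintype J] (k : J → 𝔤) {A : Submodule ℝ 𝔤}
    (hA : A ≤ Submodule.span ℝ (range k)) {v : 𝔤} (hv : v ∈ bracketSpan A A) :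
    ∃ d : IncPairs J → ℝ, ∑ x, d x • ⁅k x.1.1, k x.1.2⁆ = v := by
  rw [← Submodule.mem_span_range_iff_exists_fun]
  refine Submodule.span_le.2 ?_ hv
  have key : ∀ i j, ⁅k i, k j⁆ ∈
      Submodule.span ℝ (range fun x : IncPairs J => ⁅k x.1.1, k x.1.2⁆) := by
    intro i j
    rcases lt_trichotomy i j with h | rfl | h
    · exact Submodule.subset_span ⟨⟨(i, j), h⟩, rfl⟩
    · rw [lie_self]
      exact zero_mem _
    · rw [← lie_skew]
      exact neg_mem (Submodule.subset_span ⟨⟨(j, i), h⟩, rfl⟩)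
  rintro _ ⟨x, hx, y, hy, rfl⟩
  obtain ⟨s, rfl⟩ := (Submodule.mem_span_range_iff_exists_fun ℝ).1 (hA hx)
  obtain ⟨t, rfl⟩ := (Submodule.mem_span_range_iff_exists_fun ℝ).1 (hA hy)
  simp only [sum_lie, lie_sum, smul_lie, lie_smul]
  exact sum_mem fun i _ => Submodule.smul_mem _ _ (sum_mem fun j _ =>
    Submodule.smul_mem _ _ (key _ _))

section SkewForm

variable {ι : Type*} [LinearOrder ι] [Fintype ι]

/-- The alternating form `∑ c_{ij} (a_i b_j - a_j b_i)` on `ℝ^ι`. -/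
noncomputable def skewForm (c : IncPairs ι → ℝ) : LinearMap.BilinForm ℝ (ι → ℝ) :=
  ∑ x, c x • (LinearMap.BilinForm.linMulLin (LinearMap.proj x.1.1) (LinearMap.proj x.1.2) -
    LinearMap.BilinForm.linMulLin (LinearMap.proj x.1.2) (LinearMap.proj x.1.1))

theorem skewForm_apply (c : IncPairs ι → ℝ) (a b : ι → ℝ) :
    skewForm c a b = ∑ x, c x * (a x.1.1 * b x.1.2 - a x.1.2 * b x.1.1) := by
  simp [skewForm, LinearMap.sum_apply]

theorem skewForm_isAlt (c : IncPairs ι → ℝ) : (skewForm c).IsAlt := fun a => by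
  rw [skewForm_apply]
  exact Finset.sum_eq_zero fun x _ => by ring

theorem skewForm_eq_zero {c : IncPairs ι → ℝ} (h : skewForm c = 0) : c = 0 := by
  ext x
  have h1 : skewForm c (Pi.single x.1.1 1) (Pi.single x.1.2 1) = 0 := by rw [h]; rfl
  rw [skewForm_apply, Finset.sum_eq_single x] at h1
  · simpa [x.2.ne, x.2.ne'] using h1
  · intro y _ hy
    have h2 : ¬(y.1.1 = x.1.1 ∧ y.1.2 = x.1.2) := fun h =>
      hy (Subtype.ext (Prod.ext h.1 h.2))
    have h3 : ¬(y.1.2 = x.1.1 ∧ y.1.1 = x.1.2) := fun h => by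
      have := y.2
      rw [h.1, h.2] at this
      exact lt_asymm this x.2
    simp only [Pi.single_apply]
    split_ifs <;> simp_all
  · simp

/-- With `skewForm_eq_zero`, this turns linear independence of two relations into the absence of a
nonzero parameter with vanishing pencil member. -/
theorem pencil_skewForm (c : Fin 2 → IncPairs ι → ℝ) (s : Fin 2 → ℝ) :
    pencil (fun j => skewForm (c j)) s = skewForm (s 0 • c 0 + s 1 • c 1) := by
  ext i j
  simp only [LinearMap.comp_apply, pencil_apply, skewForm_apply,
    Finset.mul_sum, ← Finset.sum_add_distrib]
  refine Finset.sum_congr rfl fun x _ => ?_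
  simp only [Pi.add_apply, Pi.smul_apply, smul_eq_mul]
  ring

end SkewForm

/-! ### Isotropic planes in the row space of an alternating matrix -/

section RowSpace

variable {ι : Type*}

theorem exists_minor_ne_zero {a b : ι → ℝ} (ha : a ≠ 0) (hb : b ∉ Submodule.span ℝ {a}) :
    ∃ p q, a p * b q - a q * b p ≠ 0 := by
  obtain ⟨p, hp⟩ := Function.ne_iff.1 ha
  by_contra! h
  refine hb (Submodule.mem_span_singleton.2 ⟨b p / a p, ?_⟩)
  ext q
  have := h p q
  simp only [Pi.zero_apply] at hp
  simp only [Pi.smul_apply, smul_eq_mul]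
  field_simp
  linarith

/-- In a space of dimension at least four, two alternating forms have a common isotropic plane. -/
theorem exists_isotropic_of_four_le_finrank [Finite ι] (R : Submodule ℝ (ι → ℝ))
    (hR : 4 ≤ Module.finrank ℝ R) {w : Fin 2 → LinearMap.BilinForm ℝ (ι → ℝ)} :
    ∃ a ∈ R, ∃ b ∈ R, (∀ j, w j a b = 0) ∧ ∃ p q, a p * b q - a q * b p ≠ 0 := by
  obtain ⟨a, ha, ha0⟩ := R.exists_mem_ne_zero_of_ne_bot (by
    rintro rfl
    simp at hR)
  set T : R →ₗ[ℝ] (Fin 2 → ℝ) := LinearMap.pi fun j => (w j a).comp R.subtype with hT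
  have h1 := T.finrank_range_add_finrank_ker
  have h2 : Module.finrank ℝ (LinearMap.range T) ≤ 2 := by
    simpa using Submodule.finrank_le (LinearMap.range T)
  -- The kernel of `T` has dimension at least `4 - 2 = 2`, so it is not contained in the line of
  -- `a`.
  have h3 : ∃ b : R, b ∈ LinearMap.ker T ∧ (b : ι → ℝ) ∉ Submodule.span ℝ {a} := by
    by_contra! h
    have h4 : (LinearMap.ker T).map R.subtype ≤ Submodule.span ℝ {a} := by
      rintro _ ⟨b, hb, rfl⟩
      exact h b hb
    have h5 := Submodule.finrank_mono h4
    rw [finrank_span_singleton ha0, Submodule.finrank_map_subtype_eq] at h5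
    omega
  obtain ⟨b, hb, hba⟩ := h3
  refine ⟨a, ha, b, b.2, fun j => ?_, exists_minor_ne_zero ha0 hba⟩
  exact congrFun (LinearMap.mem_ker.1 hb) j

/-- The row space of a non-zero alternating matrix `Ω` contains a plane isotropic for two
alternating forms, provided that these forms vanish on the plane of `Ω` when `Ω` has rank two. -/
theorem exists_isotropic_rows [Finite ι] {Ω : ι → ι → ℝ} (hΩ : ∀ i j, Ω i j = -Ω j i) (hne : Ω ≠ 0)
    {w : Fin 2 → LinearMap.BilinForm ℝ (ι → ℝ)}
    (hw : ∀ (κ : ℝ) (a b : ι → ℝ), (∀ i j, Ω i j = κ * (a i * b j - a j * b i)) →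
      ∀ j, κ * w j a b = 0) :
    ∃ a ∈ Submodule.span ℝ (range Ω), ∃ b ∈ Submodule.span ℝ (range Ω),
      (∀ j, w j a b = 0) ∧ ∃ p q, a p * b q - a q * b p ≠ 0 := by
  have hmem : ∀ i, Ω i ∈ Submodule.span ℝ (range Ω) := fun i => Submodule.subset_span ⟨i, rfl⟩
  have hdiag : ∀ i, Ω i i = 0 := fun i => by linarith [hΩ i i]
  obtain ⟨p, hp⟩ := Function.ne_iff.1 hne
  obtain ⟨q, hpq⟩ := Function.ne_iff.1 hp
  simp only [Pi.zero_apply] at hpq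
  set κ := (Ω p q)⁻¹ with hκ
  -- Splitting off the hyperbolic plane of rows `p` and `q`: the remainder `D` vanishes exactly when
  -- `Ω` has rank two.
  by_cases hdec : ∀ i j, Ω i j = κ * (Ω p i * Ω q j - Ω p j * Ω q i)
  · refine ⟨Ω p, hmem p, Ω q, hmem q, fun j => ?_, p, q, ?_⟩
    · exact (mul_eq_zero.1 (hw κ _ _ hdec j)).resolve_left (inv_ne_zero hpq)
    · rw [hdiag, hΩ q p]
      simpa using hpq
  · push Not at hdec
    obtain ⟨k, l, hkl⟩ := hdec
    set D : ι → ι → ℝ := fun i j => Ω i j - κ * (Ω p i * Ω q j - Ω p j * Ω q i) with hD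
    have hDmem : ∀ i, D i ∈ Submodule.span ℝ (range Ω) := by
      intro i
      have : D i = Ω i - (κ * Ω p i) • Ω q + (κ * Ω q i) • Ω p := by
        ext j
        simp only [hD, Pi.add_apply, Pi.sub_apply, Pi.smul_apply, smul_eq_mul]
        ring
      rw [this]
      exact add_mem (sub_mem (hmem i) (Submodule.smul_mem _ _ (hmem q)))
        (Submodule.smul_mem _ _ (hmem p))
    have hκ1 : κ * Ω p q = 1 := inv_mul_cancel₀ hpq
    have hDp : ∀ i, D i p = 0 := fun i => by
      simp only [hD, hdiag, hΩ q p, hΩ i p]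
      linear_combination (Ω p i) * hκ1
    have hDq : ∀ i, D i q = 0 := fun i => by
      simp only [hD, hdiag, hΩ i q]
      linear_combination (Ω q i) * hκ1
    have hDsk : ∀ i j, D i j = -D j i := fun i j => by
      simp only [hD, hΩ i j]
      ring
    have hDd : ∀ i, D i i = 0 := fun i => by linarith [hDsk i i]
    have hDkl : D k l ≠ 0 := sub_ne_zero.2 hkl
    refine exists_isotropic_of_four_le_finrank _ ?_
    -- Reading a relation at the coordinates `p`, `q`, `k`, `l` in turn isolates one coefficient
    -- each time, because `D` has zero columns `p`, `q` and zero diagonal.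
    have hli : LinearIndependent ℝ ![Ω p, Ω q, D k, D l] := by
      rw [Fintype.linearIndependent_iff]
      intro g hg
      have hg' : ∀ j, g 0 * Ω p j + g 1 * Ω q j + g 2 * D k j + g 3 * D l j = 0 := fun j => by
        have := congrFun hg j
        simpa [Fin.sum_univ_four] using this
      have e1 : g 1 = 0 := by
        have := hg' p
        rw [hdiag, hDp, hDp, hΩ q p] at this
        simpa [hpq] using this
      have e0 : g 0 = 0 := by
        have := hg' q
        rw [hdiag, hDq, hDq] at this
        simpa [hpq] using this
      have e3 : g 3 = 0 := by
        have := hg' k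
        rw [hDd, e0, e1, hDsk l k] at this
        simpa [hDkl] using this
      have e2 : g 2 = 0 := by
        have := hg' l
        rw [hDd, e0, e1] at this
        simpa [hDkl] using this
      intro i
      fin_cases i <;> assumption
    have h1 := finrank_span_eq_card hli
    refine h1.ge.trans (Submodule.finrank_mono (Submodule.span_le.2 ?_))
    rintro _ ⟨i, rfl⟩
    fin_cases i
    · exact hmem p
    · exact hmem q
    · exact hDmem k
    · exact hDmem l

/-- Reduction of a basis of a plane to echelon form. -/
theorem exists_echelon (R : Submodule ℝ (ι → ℝ)) {w : Fin 2 → LinearMap.BilinForm ℝ (ι → ℝ)}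
    (halt : ∀ j, (w j).IsAlt) {a b : ι → ℝ} (ha : a ∈ R) (hb : b ∈ R) (hab : ∀ j, w j a b = 0)
    {p q : ι} (hpq : a p * b q - a q * b p ≠ 0) :
    ∃ a' ∈ R, ∃ b' ∈ R, (∀ j, w j a' b' = 0) ∧ a' p = 1 ∧ a' q = 0 ∧ b' p = 0 ∧ b' q = 1 := by
  set D := a p * b q - a q * b p with hD
  refine ⟨D⁻¹ • (b q • a - a q • b), R.smul_mem _ (sub_mem (R.smul_mem _ ha) (R.smul_mem _ hb)),
    D⁻¹ • (a p • b - b p • a), R.smul_mem _ (sub_mem (R.smul_mem _ hb) (R.smul_mem _ ha)),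
    fun j => ?_, ?_, ?_, ?_, ?_⟩
  · have h1 : w j b a = 0 := by rw [← (halt j).neg_eq, hab, neg_zero]
    simp [hab, h1, (halt j).self_eq_zero]
  all_goals
    simp only [Pi.smul_apply, Pi.sub_apply, smul_eq_mul]
    field_simp
    try rw [hD]
    try ring

end RowSpace

/-! ### The endpoint map, its differential and abnormal covectors -/

theorem AbsolutelyContinuousOnInterval.bilinear {E F G : Type*} [NormedAddCommGroup E]
    [NormedSpace ℝ E] [NormedAddCommGroup F] [NormedSpace ℝ F] [NormedAddCommGroup G]
    [NormedSpace ℝ G] (B : E →L[ℝ] F →L[ℝ] G) {f : ℝ → E} {g : ℝ → F} {a b : ℝ}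
    (hf : AbsolutelyContinuousOnInterval f a b) (hg : AbsolutelyContinuousOnInterval g a b) :
    AbsolutelyContinuousOnInterval (fun t => B (f t) (g t)) a b := by
  obtain ⟨C, hC⟩ := hf.exists_bound
  obtain ⟨D, hD⟩ := hg.exists_bound
  unfold AbsolutelyContinuousOnInterval at hf hg
  refine squeeze_zero' (Filter.Eventually.of_forall fun _ => Finset.sum_nonneg fun _ _ =>
    dist_nonneg) ?_ (by simpa using (hg.const_mul (‖B‖ * C)).add (hf.const_mul (‖B‖ * D)))
  rw [Filter.eventually_inf_principal]
  refine Filter.Eventually.of_forall ?_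
  rintro ⟨n, I⟩ hnI
  simp only [Finset.mul_sum, ← Finset.sum_add_distrib]
  refine Finset.sum_le_sum fun i hi => ?_
  obtain ⟨h1, h2⟩ := hnI.1 i hi
  have e : B (f (I i).1) (g (I i).1) - B (f (I i).2) (g (I i).2) =
      B (f (I i).1) (g (I i).1 - g (I i).2) + B (f (I i).1 - f (I i).2) (g (I i).2) := by
    simp only [map_sub, sub_apply]
    abel
  simp only [dist_eq_norm]
  rw [e]
  refine (norm_add_le _ _).trans (add_le_add ?_ ?_)
  · refine (B.le_opNorm₂ _ _).trans ?_
    gcongr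
    exact hC _ h1
  · refine (B.le_opNorm₂ _ _).trans ?_
    rw [mul_right_comm]
    gcongr
    exact hD _ h2

namespace CarnotGroup

variable {𝔤 : Type*} [NormedLieRing 𝔤] [NormedRealLieAlgebra 𝔤]
  {V₁ V₂ : Submodule ℝ 𝔤} (h : IsStepTwoStratification V₁ V₂)

instance isProbabilityMeasure_unitInterval :
    IsProbabilityMeasure ((volume : Measure ℝ).restrict (Icc 0 1)) := ⟨by simp⟩

theorem integral_norm_control_le (u : Control h) :
    ∫ s in (0 : ℝ)..1, ‖(u s : 𝔤)‖ ≤ ‖u‖ := by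
  have hm : AEStronglyMeasurable u (volume.restrict (Icc (0 : ℝ) 1)) :=
    (Lp.memLp u).aestronglyMeasurable
  rw [intervalIntegral.integral_of_le zero_le_one, ← integral_Icc_eq_integral_Ioc, Lp.norm_def]
  change ∫ s in Icc (0 : ℝ) 1, ‖u s‖ ≤ _
  rw [integral_norm_eq_lintegral_enorm hm, ← eLpNorm_one_eq_lintegral_enorm]
  exact ENNReal.toReal_mono (Lp.memLp u).eLpNorm_ne_top
    (eLpNorm_le_eLpNorm_of_exponent_le (by norm_num) hm)

/-- The horizontal component `t ↦ ∫₀ᵗ u` of a trajectory. -/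
noncomputable def primitive (u : Control h) (t : ℝ) : 𝔤 := ∫ s in (0 : ℝ)..t, (u s : 𝔤)

variable {h}

theorem control_intervalIntegrable_zero (u : Control h) {t : ℝ} (ht : t ∈ Icc (0 : ℝ) 1) :
    IntervalIntegrable (fun s => (u s : 𝔤)) volume 0 t :=
  (control_intervalIntegrable h u).mono_set
    (uIcc_subset_uIcc left_mem_uIcc (by rwa [uIcc_of_le zero_le_one]))

theorem integral_congr_on_unitInterval {E : Type*} [NormedAddCommGroup E] [NormedSpace ℝ E]
    {f g : ℝ → E} {t : ℝ} (ht : t ∈ Icc (0 : ℝ) 1)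
    (hfg : f =ᵐ[volume.restrict (Icc (0 : ℝ) 1)] g) :
    ∫ s in (0 : ℝ)..t, f s = ∫ s in (0 : ℝ)..t, g s := by
  refine intervalIntegral.integral_congr_ae_restrict (ae_restrict_of_ae_restrict_of_subset ?_ hfg)
  rw [uIoc_of_le ht.1]
  exact Ioc_subset_Icc_self.trans (Icc_subset_Icc_right ht.2)

theorem primitive_zero (u : Control h) : primitive h u 0 = 0 := by simp [primitive]

theorem primitive_add (u v : Control h) {t : ℝ} (ht : t ∈ Icc (0 : ℝ) 1) :
    primitive h (u + v) t = primitive h u t + primitive h v t := by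
  unfold primitive
  rw [← intervalIntegral.integral_add (control_intervalIntegrable_zero u ht)
    (control_intervalIntegrable_zero v ht)]
  refine integral_congr_on_unitInterval ht ?_
  filter_upwards [Lp.coeFn_add u v] with s hs
  rw [hs]
  rfl

theorem primitive_smul (c : ℝ) (u : Control h) {t : ℝ} (ht : t ∈ Icc (0 : ℝ) 1) :
    primitive h (c • u) t = c • primitive h u t := by
  unfold primitive
  rw [← intervalIntegral.integral_smul]
  refine integral_congr_on_unitInterval ht ?_
  filter_upwards [Lp.coeFn_smul c u] with s hs
  rw [hs]
  rfl

theorem norm_primitive_le (u : Control h) {t : ℝ} (ht : t ∈ Icc (0 : ℝ) 1) :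
    ‖primitive h u t‖ ≤ ‖u‖ := by
  refine (intervalIntegral.norm_integral_le_integral_norm ht.1).trans
    (le_trans ?_ (integral_norm_control_le h u))
  exact intervalIntegral.integral_mono_interval le_rfl ht.1 ht.2
    (Filter.Eventually.of_forall fun _ => norm_nonneg _) (control_intervalIntegrable h u).norm

theorem primitive_absolutelyContinuous (u : Control h) :
    AbsolutelyContinuousOnInterval (primitive h u) 0 1 :=
  absCont_integral (control_intervalIntegrable h u)

theorem primitive_continuousOn (u : Control h) : ContinuousOn (primitive h u) (Icc 0 1) := by
  simpa [uIcc_of_le] using (primitive_absolutelyContinuous u).continuousOn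

/-- The continuous linear map `u ↦ ∫₀¹ u`. -/
noncomputable def totalIntegral (h : IsStepTwoStratification V₁ V₂) : Control h →L[ℝ] 𝔤 :=
  LinearMap.mkContinuous
    { toFun := fun u => primitive h u 1
      map_add' := fun u v => primitive_add u v (right_mem_Icc.2 zero_le_one)
      map_smul' := fun c u => primitive_smul c u (right_mem_Icc.2 zero_le_one) } 1
    fun u => by simpa using norm_primitive_le u (right_mem_Icc.2 zero_le_one)

theorem totalIntegral_apply (u : Control h) : totalIntegral h u = primitive h u 1 := rfl

/-- The radical in `V₁` of the form `(x, y) ↦ φ [x, y]`. -/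
def radical (V₁ : Submodule ℝ 𝔤) (φ : 𝔤 →ₗ[ℝ] ℝ) : Submodule ℝ 𝔤 where
  carrier := {x | x ∈ V₁ ∧ ∀ y ∈ V₁, φ ⁅x, y⁆ = 0}
  add_mem' := fun ha hb => ⟨V₁.add_mem ha.1 hb.1, fun y hy => by
    rw [add_lie, map_add, ha.2 y hy, hb.2 y hy, add_zero]⟩
  zero_mem' := ⟨V₁.zero_mem, fun y _ => by simp⟩
  smul_mem' := fun c x hx => ⟨V₁.smul_mem c hx.1, fun y hy => by
    rw [smul_lie, map_smul, hx.2 y hy, smul_zero]⟩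

section FiniteDimensional

variable [FiniteDimensional ℝ 𝔤]

theorem primitive_mem (u : Control h) {t : ℝ} (ht : t ∈ Icc (0 : ℝ) 1) :
    primitive h u t ∈ V₁ := by
  have h1 : IntervalIntegrable u volume 0 t := by
    have h2 : IntervalIntegrable u volume 0 1 := by
      rw [intervalIntegrable_iff_integrableOn_Icc_of_le zero_le_one]
      exact (Lp.memLp u).integrable (by norm_num)
    exact h2.mono_set (uIcc_subset_uIcc left_mem_uIcc (by rwa [uIcc_of_le zero_le_one]))
  have h3 := V₁.subtypeL.intervalIntegral_comp_comm h1
  change primitive h u t = _ at h3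
  rw [h3]
  exact Subtype.property _

theorem ae_hasDerivAt_primitive (u : Control h) :
    ∀ᵐ t, t ∈ Icc (0 : ℝ) 1 → HasDerivAt (primitive h u) (u t : 𝔤) t := by
  filter_upwards [(control_intervalIntegrable h u).ae_hasDerivAt_integral] with t h1 ht
  exact h1 (by rwa [uIcc_of_le zero_le_one]) 0 left_mem_uIcc

theorem intervalIntegrable_lie (v : Control h) {x : ℝ → 𝔤} (hx : ContinuousOn x (Icc 0 1)) :
    IntervalIntegrable (fun s => lieCLM 𝔤 (x s) (v s : 𝔤)) volume 0 1 := by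
  have hv := control_intervalIntegrable h v
  have hc : ContinuousOn (fun s => lieCLM 𝔤 (x s)) (Icc 0 1) :=
    (lieCLM 𝔤).continuous.comp_continuousOn hx
  rw [intervalIntegrable_iff_integrableOn_Icc_of_le zero_le_one] at hv ⊢
  obtain ⟨C, hC⟩ := isCompact_Icc.exists_bound_of_continuousOn hc
  refine Integrable.mono' (hv.norm.const_mul C) ?_ ?_
  · have hm := hc.aestronglyMeasurable measurableSet_Icc (μ := volume)
    exact (ContinuousLinearMap.apply ℝ 𝔤).flip.aestronglyMeasurable_comp₂ hm hv.1
  · refine (ae_restrict_iff' measurableSet_Icc).2 (Filter.Eventually.of_forall fun t ht => ?_)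
    exact ((lieCLM 𝔤 (x t)).le_opNorm _).trans
      (mul_le_mul_of_nonneg_right (hC t ht) (norm_nonneg _))

/-- The integral term is central, so it drops out of the bracket in the equation of the curve, which
becomes a plain quadrature. -/
theorem isTrajectory_explicit (u : Control h) :
    IsTrajectory h u fun t => exp h (primitive h u t +
      ∫ s in (0 : ℝ)..t, (2⁻¹ : ℝ) • lieCLM 𝔤 (primitive h u s) (u s : 𝔤)) := by
  set f : ℝ → 𝔤 := fun s => (2⁻¹ : ℝ) • lieCLM 𝔤 (primitive h u s) (u s : 𝔤) with hf
  have hfi : IntervalIntegrable f volume 0 1 :=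
    (intervalIntegrable_lie u (primitive_continuousOn u)).smul _
  have hzero : ∀ t ∈ Icc (0 : ℝ) 1, ∀ v : 𝔤, ⁅∫ s in (0 : ℝ)..t, f s, v⁆ = 0 := by
    intro t ht v
    have hsub : uIcc 0 t ⊆ uIcc (0 : ℝ) 1 :=
      uIcc_subset_uIcc left_mem_uIcc (by rwa [uIcc_of_le zero_le_one])
    have h1 := ((lieCLM 𝔤).flip v).intervalIntegral_comp_comm (hfi.mono_set hsub)
    have h2 : ∀ s, (lieCLM 𝔤).flip v (f s) = 0 := by
      intro s
      simp only [ContinuousLinearMap.flip_apply, lieCLM_apply, hf, smul_lie,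
        h.lie_lie_eq_zero, smul_zero]
    simp only [h2, intervalIntegral.integral_zero] at h1
    exact h1.symm
  refine ⟨by simp [primitive_zero, one_eq], absCont_comp_clm (exp h).toContinuousLinearMap
    ((primitive_absolutelyContinuous u).add (absCont_integral hfi)), ?_⟩
  rw [ae_restrict_iff' measurableSet_Icc]
  filter_upwards [ae_hasDerivAt_primitive u, hfi.ae_hasDerivAt_integral] with t h1 h2 ht
  have ht' : t ∈ uIcc (0 : ℝ) 1 := by rwa [uIcc_of_le zero_le_one]
  have h3 := (h1 ht).add (h2 ht' 0 left_mem_uIcc)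
  rw [leftDiff_apply, add_lie, hzero t ht, add_zero]
  exact (exp h).toContinuousLinearMap.hasFDerivAt.comp_hasDerivAt t h3

/-- The bilinear map `(u, v) ↦ ∫₀¹ [∫₀ˢ u, v(s)] ds` on the space of controls. -/
noncomputable def lieArea (h : IsStepTwoStratification V₁ V₂) :
    Control h →L[ℝ] Control h →L[ℝ] 𝔤 :=
  LinearMap.mkContinuous₂
    (LinearMap.mk₂ ℝ
      (fun u v => ∫ s in (0 : ℝ)..1, lieCLM 𝔤 (primitive h u s) (v s : 𝔤))
      (fun u u' v => by
        rw [← intervalIntegral.integral_add (intervalIntegrable_lie v (primitive_continuousOn u))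
          (intervalIntegrable_lie v (primitive_continuousOn u'))]
        refine integral_congr_on_unitInterval (right_mem_Icc.2 zero_le_one) ?_
        filter_upwards [ae_restrict_mem measurableSet_Icc] with s hs
        rw [primitive_add u u' hs, map_add, add_apply])
      (fun c u v => by
        rw [← intervalIntegral.integral_smul]
        refine integral_congr_on_unitInterval (right_mem_Icc.2 zero_le_one) ?_
        filter_upwards [ae_restrict_mem measurableSet_Icc] with s hs
        rw [primitive_smul c u hs, map_smul, smul_apply])
      (fun u v v' => by
        rw [← intervalIntegral.integral_add (intervalIntegrable_lie v (primitive_continuousOn u))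
          (intervalIntegrable_lie v' (primitive_continuousOn u))]
        refine integral_congr_on_unitInterval (right_mem_Icc.2 zero_le_one) ?_
        filter_upwards [Lp.coeFn_add v v'] with s hs
        rw [hs, Pi.add_apply, Submodule.coe_add, map_add])
      (fun c u v => by
        rw [← intervalIntegral.integral_smul]
        refine integral_congr_on_unitInterval (right_mem_Icc.2 zero_le_one) ?_
        filter_upwards [Lp.coeFn_smul c v] with s hs
        rw [hs, Pi.smul_apply, Submodule.coe_smul, map_smul]))
    ‖lieCLM 𝔤‖ (fun u v => by
      have h1 : ∀ s ∈ Icc (0 : ℝ) 1, ‖lieCLM 𝔤 (primitive h u s) (v s : 𝔤)‖ ≤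
          ‖lieCLM 𝔤‖ * ‖u‖ * ‖(v s : 𝔤)‖ := fun s hs => by
        refine ((lieCLM 𝔤).le_opNorm₂ _ _).trans ?_
        gcongr
        exact norm_primitive_le u hs
      refine (intervalIntegral.norm_integral_le_integral_norm zero_le_one).trans ?_
      refine (intervalIntegral.integral_mono_on zero_le_one
        (intervalIntegrable_lie v (primitive_continuousOn u)).norm
        ((control_intervalIntegrable h v).norm.const_mul _) h1).trans ?_
      rw [intervalIntegral.integral_const_mul]
      gcongr
      exact integral_norm_control_le h v)

theorem lieArea_apply (u v : Control h) :
    lieArea h u v = ∫ s in (0 : ℝ)..1, lieCLM 𝔤 (primitive h u s) (v s : 𝔤) := rfl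

theorem endpoint_eq (u : Control h) :
    endpoint h u = exp h (totalIntegral h u + (2⁻¹ : ℝ) • lieArea h u u) := by
  have h1 := (trajectory_spec h u).eqOn h (isTrajectory_explicit u) (right_mem_Icc.2 zero_le_one)
  rw [endpoint, h1, intervalIntegral.integral_smul]
  rfl

/-- Integration by parts: the absolutely continuous function `H` has zero derivative almost
everywhere, hence is constant. -/
theorem lieArea_swap (u v : Control h) :
    lieArea h v u = ⁅primitive h v 1, primitive h u 1⁆ + lieArea h u v := by
  have i1 := intervalIntegrable_lie u (primitive_continuousOn v)
  have i2 := intervalIntegrable_lie v (primitive_continuousOn u)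
  set H : ℝ → 𝔤 := fun t => lieCLM 𝔤 (primitive h v t) (primitive h u t) +
    ((∫ s in (0 : ℝ)..t, lieCLM 𝔤 (primitive h u s) (v s : 𝔤)) -
      ∫ s in (0 : ℝ)..t, lieCLM 𝔤 (primitive h v s) (u s : 𝔤)) with hH
  have hac : AbsolutelyContinuousOnInterval H 0 1 :=
    ((primitive_absolutelyContinuous v).bilinear (lieCLM 𝔤)
      (primitive_absolutelyContinuous u)).add ((absCont_integral i2).sub (absCont_integral i1))
  obtain ⟨C, hC⟩ := hac.const_of_ae_hasDerivAt_zero (by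
    filter_upwards [ae_hasDerivAt_primitive u, ae_hasDerivAt_primitive v,
      i1.ae_hasDerivAt_integral, i2.ae_hasDerivAt_integral] with t hu hv h1 h2 ht
    have ht' : t ∈ Icc (0 : ℝ) 1 := by rwa [uIcc_of_le zero_le_one] at ht
    have h3 := (((lieCLM 𝔤).hasFDerivAt.comp_hasDerivAt t (hv ht')).clm_apply (hu ht')).add
      ((h2 ht 0 left_mem_uIcc).sub (h1 ht 0 left_mem_uIcc))
    refine h3.congr_deriv ?_
    simp only [Function.comp_apply, lieCLM_apply]
    rw [← lie_skew (primitive h u t) (v t : 𝔤)]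
    abel)
  have h0 := hC 0 left_mem_uIcc
  have h1 := hC 1 right_mem_uIcc
  rw [← h0] at h1
  simp only [hH, primitive_zero, map_zero, intervalIntegral.integral_same, sub_zero, add_zero]
    at h1
  rw [lieArea_apply, lieArea_apply, ← lieCLM_apply]
  rw [← sub_eq_zero, ← neg_eq_zero, ← h1]
  abel

theorem hasFDerivAt_endpoint (u : Control h) :
    HasFDerivAt (endpoint h) ((exp h : 𝔤 →L[ℝ] CarnotGroup h).comp
      (totalIntegral h + (2⁻¹ : ℝ) • (lieArea h u + (lieArea h).flip u))) u := by
  have h1 : HasFDerivAt (fun u => lieArea h u u) (lieArea h u + (lieArea h).flip u) u := by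
    have := (lieArea h).hasFDerivAt_of_bilinear (hasFDerivAt_id u) (hasFDerivAt_id u)
    refine this.congr_fderiv ?_
    ext v
    simp
  have h2 := ((totalIntegral h).hasFDerivAt (x := u)).add (h1.const_smul (2⁻¹ : ℝ))
  have h3 := (exp h : 𝔤 →L[ℝ] CarnotGroup h).hasFDerivAt.comp u h2
  have h4 : endpoint h = (exp h : 𝔤 →L[ℝ] CarnotGroup h) ∘
      (fun u => totalIntegral h u + (2⁻¹ : ℝ) • lieArea h u u) := funext endpoint_eq
  rw [h4]
  exact h3

/-- `lieArea_swap` moves the variation `v` out of the primitive, leaving a single integral against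
`v`, suited to testing with arbitrary controls. -/
theorem fderiv_endpoint_apply (u v : Control h) :
    (exp h).symm (fderiv ℝ (endpoint h) u v) =
      ∫ s in (0 : ℝ)..1, ((v s : 𝔤) +
        lieCLM 𝔤 (primitive h u s - (2⁻¹ : ℝ) • primitive h u 1) (v s : 𝔤)) := by
  have hc : ContinuousOn (fun s => primitive h u s - (2⁻¹ : ℝ) • primitive h u 1) (Icc 0 1) :=
    (primitive_continuousOn u).sub continuousOn_const
  have hv := control_intervalIntegrable h v
  rw [(hasFDerivAt_endpoint u).fderiv, intervalIntegral.integral_add hv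
    (intervalIntegrable_lie v hc)]
  change totalIntegral h v + (2⁻¹ : ℝ) • (lieArea h u v + lieArea h v u) = _
  rw [lieArea_swap u v, totalIntegral_apply]
  simp only [map_sub, sub_apply]
  rw [intervalIntegral.integral_sub (intervalIntegrable_lie v (primitive_continuousOn u))
    (intervalIntegrable_lie v continuousOn_const),
    ContinuousLinearMap.intervalIntegral_comp_comm _ hv, ← lieArea_apply]
  change _ = primitive h v 1 + (lieArea h u v - ⁅(2⁻¹ : ℝ) • primitive h u 1, primitive h v 1⁆)
  rw [← lie_skew (primitive h v 1) (primitive h u 1), smul_lie]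
  module

/-- The covector of an abnormal curve. -/
theorem IsAbnormal.exists_covector {u : Control h} (hu : IsAbnormal h u) :
    ∃ φ : 𝔤 →ₗ[ℝ] ℝ, φ ≠ 0 ∧ (∀ y ∈ V₁, φ y = 0) ∧
      ∀ t ∈ Icc (0 : ℝ) 1, primitive h u t ∈ radical V₁ φ := by
  obtain ⟨f, hf0, hf⟩ := Submodule.exists_le_ker_of_lt_top _ (lt_top_iff_ne_top.2 hu)
  set φ : 𝔤 →ₗ[ℝ] ℝ := f ∘ₗ ((exp h : 𝔤 →L[ℝ] CarnotGroup h) : 𝔤 →ₗ[ℝ] CarnotGroup h) with hφ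
  set φL : 𝔤 →L[ℝ] ℝ := LinearMap.toContinuousLinearMap φ with hφL
  have hφ0 : φ ≠ 0 := by
    intro h0
    refine hf0 (LinearMap.ext fun g => ?_)
    have := LinearMap.congr_fun h0 ((exp h).symm g)
    simpa [hφ] using this
  have hker : ∀ v : Control h, φL (∫ s in (0 : ℝ)..1, ((v s : 𝔤) +
      lieCLM 𝔤 (primitive h u s - (2⁻¹ : ℝ) • primitive h u 1) (v s : 𝔤))) = 0 := by
    intro v
    rw [← fderiv_endpoint_apply]
    have := hf (LinearMap.mem_range_self _ v)
    simpa [hφL, hφ] using this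
  have hc : ContinuousOn (fun s => primitive h u s - (2⁻¹ : ℝ) • primitive h u 1) (Icc 0 1) :=
    (primitive_continuousOn u).sub continuousOn_const
  have key : ∀ y ∈ V₁, ∀ s ∈ Icc (0 : ℝ) 1,
      φ (y + ⁅primitive h u s - (2⁻¹ : ℝ) • primitive h u 1, y⁆) = 0 := by
    intro y hy
    -- Testing against the control `ψ(s) y` gives `∫ ψ² = 0`; as `ψ` is continuous, it vanishes
    -- identically.
    set ψ : ℝ → ℝ := fun s =>
      φL (y + lieCLM 𝔤 (primitive h u s - (2⁻¹ : ℝ) • primitive h u 1) y) with hψ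
    have hψc : ContinuousOn ψ (Icc 0 1) := φL.continuous.comp_continuousOn
      (continuousOn_const.add (((lieCLM 𝔤).flip y).continuous.comp_continuousOn hc))
    have hm : MemLp (fun s => ψ s • (⟨y, hy⟩ : V₁)) 2 (volume.restrict (Icc (0 : ℝ) 1)) := by
      have hc' : ContinuousOn (fun s => ψ s • (⟨y, hy⟩ : V₁)) (Icc 0 1) :=
        hψc.smul continuousOn_const
      obtain ⟨C, hC⟩ := isCompact_Icc.exists_bound_of_continuousOn hc'
      exact MemLp.of_bound (hc'.aestronglyMeasurable measurableSet_Icc) C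
        ((ae_restrict_iff' measurableSet_Icc).2 (Filter.Eventually.of_forall hC))
    set v : Control h := hm.toLp with hv
    have h1 := hker v
    have h2 : ∫ s in (0 : ℝ)..1, ((v s : 𝔤) +
        lieCLM 𝔤 (primitive h u s - (2⁻¹ : ℝ) • primitive h u 1) (v s : 𝔤)) =
        ∫ s in (0 : ℝ)..1, ψ s •
          (y + lieCLM 𝔤 (primitive h u s - (2⁻¹ : ℝ) • primitive h u 1) y) := by
      refine integral_congr_on_unitInterval (right_mem_Icc.2 zero_le_one) ?_
      filter_upwards [hm.coeFn_toLp] with s hs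
      rw [hv, hs]
      simp [smul_add]
    have hci : IntervalIntegrable (fun s => ψ s •
        (y + lieCLM 𝔤 (primitive h u s - (2⁻¹ : ℝ) • primitive h u 1) y)) volume 0 1 := by
      refine ContinuousOn.intervalIntegrable ?_
      rw [uIcc_of_le zero_le_one]
      exact hψc.smul
        (continuousOn_const.add (((lieCLM 𝔤).flip y).continuous.comp_continuousOn hc))
    rw [h2, ← φL.intervalIntegral_comp_comm hci] at h1
    by_contra! hcon
    obtain ⟨s, hs, hne⟩ := hcon
    have h3 : 0 < ∫ s in (0 : ℝ)..1, ψ s * ψ s :=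
      intervalIntegral.integral_pos one_pos (hψc.mul hψc) (fun _ _ => mul_self_nonneg _)
        ⟨s, hs, mul_self_pos.2 hne⟩
    simp only [map_smul, smul_eq_mul] at h1
    exact h3.ne' h1
  -- At `s = 0` the identity reads `φ y = ½ φ [x(1), y]`. Subtracting it from the identity at `t`
  -- gives `φ [x(t), y] = 0`, and `t = 1` then gives `φ y = 0`.
  have h0 : ∀ y ∈ V₁, φ y - 2⁻¹ * φ ⁅primitive h u 1, y⁆ = 0 := fun y hy => by
    have := key y hy 0 (left_mem_Icc.2 zero_le_one)
    rw [primitive_zero, zero_sub, neg_lie, smul_lie, map_add, map_neg, map_smul] at this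
    simpa [sub_eq_add_neg] using this
  have h1 : ∀ t ∈ Icc (0 : ℝ) 1, ∀ y ∈ V₁, φ ⁅primitive h u t, y⁆ = 0 := fun t ht y hy => by
    have e1 := key y hy t ht
    have e2 := h0 y hy
    rw [sub_lie, smul_lie, map_add, map_sub, map_smul, smul_eq_mul] at e1
    linarith
  refine ⟨φ, hφ0, fun y hy => ?_, fun t ht => ⟨primitive_mem u ht, h1 t ht⟩⟩
  have e1 := h0 y hy
  rw [h1 1 (right_mem_Icc.2 zero_le_one) y hy] at e1
  linarith

/-- A curve whose horizontal component stays in the subspace `A` ends in `A + [A, A]`. -/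
theorem endpoint_mem_of_primitive_mem {u : Control h} {A : Submodule ℝ 𝔤}
    (hA : ∀ t ∈ Icc (0 : ℝ) 1, primitive h u t ∈ A) :
    ∃ x ∈ A, ∃ y ∈ bracketSpan A A, endpoint h u = exp h (x + y) := by
  have hu : ∀ᵐ t ∂(volume.restrict (Icc (0 : ℝ) 1)), (u t : 𝔤) ∈ A := by
    rw [ae_restrict_iff' measurableSet_Icc]
    filter_upwards [ae_hasDerivAt_primitive u, compl_mem_ae_iff.2 (measure_singleton (1 : ℝ))]
      with t h1 ht1 ht
    -- Discarding the null set `{1}` leaves room on the right of `t` for difference quotients, which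
    -- lie in the closed subspace `A`.
    have ht2 : t < 1 := lt_of_le_of_ne ht.2 ht1
    have h3 := (hasDerivWithinAt_iff_tendsto_slope' (by simp)).1
      ((h1 ht).hasDerivWithinAt (s := Ioo t 1))
    have : (nhdsWithin t (Ioo t 1)).NeBot := by
      rw [nhdsWithin_Ioo_eq_nhdsGT ht2]
      infer_instance
    refine A.closed_of_finiteDimensional.mem_of_tendsto h3 ?_
    filter_upwards [self_mem_nhdsWithin] with s hs
    exact A.smul_mem _ (A.sub_mem (hA s ⟨ht.1.trans hs.1.le, hs.2.le⟩) (hA t ht))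
  refine ⟨primitive h u 1, hA 1 (right_mem_Icc.2 zero_le_one), (2⁻¹ : ℝ) • lieArea h u u, ?_,
    endpoint_eq u⟩
  refine Submodule.smul_mem _ _ ?_
  have hi := intervalIntegrable_lie u (primitive_continuousOn u)
  rw [intervalIntegrable_iff_integrableOn_Icc_of_le zero_le_one] at hi
  rw [lieArea_apply, intervalIntegral.integral_of_le zero_le_one, ← integral_Icc_eq_integral_Ioc]
  -- The measure on `[0,1]` has mass one, so the integral is a mean of points of a closed convex
  -- set.
  refine (bracketSpan A A).convex.integral_mem (bracketSpan A A).closed_of_finiteDimensional ?_ hi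
  filter_upwards [hu, ae_restrict_mem measurableSet_Icc] with s hs hs'
  exact Submodule.subset_span ⟨_, hA s hs', _, hs, rfl⟩

end FiniteDimensional

end CarnotGroup

/-! ### Coordinates on planes of covectors and their kernels -/

section Plane

variable {r : ℕ} (p q : Fin r)

/-- The indices other than `p` and `q`. -/
abbrev Rest : Type := {i : Fin r // i ≠ p ∧ i ≠ q}

/-- The standard basis vectors other than those of index `p` and `q`. -/
def restVec (j : Rest p q) : Fin r → ℝ := Pi.single j.1 1

variable {p q}

theorem affinePoint_restVec (hpq : p ≠ q) {a : Fin r → ℝ} {s t : Fin r} (hst : s = p ∧ t = q ∨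
    s = q ∧ t = p) (hs : a s = 1) (ht : a t = 0) :
    affinePoint (Pi.single s 1) (restVec p q) (fun j => a j) = a := by
  have h1 := (Pi.basisFun ℝ (Fin r)).sum_repr a
  simp only [Pi.basisFun_apply, Pi.basisFun_repr] at h1
  rw [sum_eq_add_add_sum_ne_and_ne hpq] at h1
  conv_rhs => rw [← h1]
  rcases hst with ⟨rfl, rfl⟩ | ⟨rfl, rfl⟩ <;> simp [affinePoint, restVec, hs, ht]

theorem span_restVec : Submodule.span ℝ (insert (Pi.single p (1 : ℝ))
    (insert (Pi.single q 1) (range (restVec p q)))) = ⊤ := by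
  rw [eq_top_iff, ← (Pi.basisFun ℝ (Fin r)).span_eq, Submodule.span_le]
  rintro _ ⟨i, rfl⟩
  rw [Pi.basisFun_apply]
  by_cases hp : i = p
  · subst hp
    exact Submodule.subset_span (mem_insert _ _)
  · by_cases hq : i = q
    · subst hq
      exact Submodule.subset_span (mem_insert_of_mem _ (mem_insert _ _))
    · exact Submodule.subset_span
        (mem_insert_of_mem _ (mem_insert_of_mem _ ⟨⟨i, hp, hq⟩, rfl⟩))

variable {𝔤 : Type*} [NormedLieRing 𝔤] [NormedRealLieAlgebra 𝔤]

/-- The vectors `e_j - α_j e_p - β_j e_q`, a basis of the common kernel of the covectors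
`e_p + ∑ α_j e_j` and `e_q + ∑ β_j e_j`. -/
def kernelVec (e : Fin r → 𝔤) (x : Rest p q ⊕ Rest p q → ℝ) (j : Rest p q) : 𝔤 :=
  e j - x (Sum.inl j) • e p - x (Sum.inr j) • e q

/-- The echelon form of `a` and `b` expresses `v p` and `v q` through the other `v j`, which are
then the coefficients on the kernel vectors. -/
theorem mem_span_kernelVec (hpq : p ≠ q) (e : Fin r → 𝔤) {a b v : Fin r → ℝ} (hap : a p = 1)
    (haq : a q = 0) (hbp : b p = 0) (hbq : b q = 1) (hav : ∑ i, a i * v i = 0)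
    (hbv : ∑ i, b i * v i = 0) :
    ∑ i, v i • e i ∈
      Submodule.span ℝ (range (kernelVec e (Sum.elim (fun j : Rest p q => a j) fun j => b j))) := by
  rw [Submodule.mem_span_range_iff_exists_fun]
  refine ⟨fun j => v j, ?_⟩
  rw [sum_eq_add_add_sum_ne_and_ne hpq] at hav hbv ⊢
  rw [hap, haq, one_mul, zero_mul, add_zero] at hav
  rw [hbp, hbq, one_mul, zero_mul, zero_add] at hbv
  rw [eq_neg_of_add_eq_zero_left hav, eq_neg_of_add_eq_zero_left hbv]
  simp only [kernelVec, Sum.elim_inl, Sum.elim_inr, smul_sub, Finset.sum_sub_distrib, neg_smul,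
    Finset.sum_smul, smul_smul, mul_comm (v _)]
  abel

theorem isPolyFun_kernelVec {κ : Type*} (L : 𝔤 →ₗ[ℝ] ℝ) (e : Fin r → 𝔤)
    (ν : Rest p q ⊕ Rest p q → κ) (j : Rest p q) :
    IsPolyFun fun x : κ → ℝ => L (kernelVec e (x ∘ ν) j) := by
  simp only [kernelVec, map_sub, map_smul, smul_eq_mul, Function.comp_apply]
  exact ((IsPolyFun.const _).sub ((IsPolyFun.coord (ν (Sum.inl j))).mul (IsPolyFun.const _))).sub
    ((IsPolyFun.coord (ν (Sum.inr j))).mul (IsPolyFun.const _))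

theorem isPolyFun_lie_kernelVec {κ : Type*} (L : 𝔤 →ₗ[ℝ] ℝ) (e : Fin r → 𝔤)
    (ν : Rest p q ⊕ Rest p q → κ) (i j : Rest p q) :
    IsPolyFun fun x : κ → ℝ => L ⁅kernelVec e (x ∘ ν) i, kernelVec e (x ∘ ν) j⁆ := by
  have h1 : ∀ y : 𝔤, IsPolyFun fun x : κ → ℝ => L ⁅kernelVec e (x ∘ ν) i, y⁆ := by
    intro y
    simp only [kernelVec, sub_lie, smul_lie, map_sub, map_smul, smul_eq_mul, Function.comp_apply]
    exact ((IsPolyFun.const _).sub ((IsPolyFun.coord (ν (Sum.inl i))).mul (IsPolyFun.const _))).sub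
      ((IsPolyFun.coord (ν (Sum.inr i))).mul (IsPolyFun.const _))
  have h2 : ∀ x : κ → ℝ, L ⁅kernelVec e (x ∘ ν) i, kernelVec e (x ∘ ν) j⁆ =
      L ⁅kernelVec e (x ∘ ν) i, e j⁆ - x (ν (Sum.inl j)) * L ⁅kernelVec e (x ∘ ν) i, e p⁆ -
        x (ν (Sum.inr j)) * L ⁅kernelVec e (x ∘ ν) i, e q⁆ := by
    intro x
    conv_lhs => rw [kernelVec.eq_def (j := j)]
    simp only [lie_sub, lie_smul, map_sub, map_smul, smul_eq_mul, Function.comp_apply]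
  simp only [h2]
  exact ((h1 _).sub ((IsPolyFun.coord _).mul (h1 _))).sub ((IsPolyFun.coord _).mul (h1 _))

end Plane

theorem sum_repr_coe {E ι : Type*} [AddCommGroup E] [Module ℝ E] [Fintype ι] {V : Submodule ℝ E}
    (e : Module.Basis ι ℝ V) {v : E} (hv : v ∈ V) : ∑ i, e.repr ⟨v, hv⟩ i • (e i : E) = v := by
  have h1 := congrArg ((↑) : V → E) (e.sum_repr ⟨v, hv⟩)
  simpa only [Submodule.coe_sum, Submodule.coe_smul] using h1

/-! ### Parametrization of the abnormal set and the dimension count -/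

namespace CarnotGroup

variable {𝔤 : Type*} [NormedLieRing 𝔤] [NormedRealLieAlgebra 𝔤]
  {V₁ V₂ : Submodule ℝ 𝔤} (h : IsStepTwoStratification V₁ V₂)

section FiniteDimensional

variable [FiniteDimensional ℝ 𝔤] {r : ℕ}

/-- Rank-nullity for the map from formal combinations of basis brackets to `V₂`. -/
theorem exists_relations (e : Module.Basis (Fin r) ℝ V₁) (h : IsStepTwoStratification V₁ V₂) (hr : Fintype.card (IncPairs (Fin r)) = Module.finrank ℝ V₂ + 2) :
    ∃ c : Fin 2 → IncPairs (Fin r) → ℝ, LinearIndependent ℝ c ∧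
      ∀ j, ∑ x, c j x • ⁅(e x.1.1 : 𝔤), (e x.1.2 : 𝔤)⁆ = 0 := by
  set Ψ := Fintype.linearCombination ℝ
    (fun x : IncPairs (Fin r) => ⁅(e x.1.1 : 𝔤), (e x.1.2 : 𝔤)⁆) with hΨ
  have h1 := Ψ.finrank_range_add_finrank_ker
  rw [Module.finrank_fintype_fun_eq_card, hr] at h1
  have h2 : LinearMap.range Ψ ≤ V₂ := by
    rintro _ ⟨c, rfl⟩
    rw [hΨ, Fintype.linearCombination_apply]
    exact sum_mem fun x _ => V₂.smul_mem _ (h.lie_mem' _ _)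
  have h3 := Submodule.finrank_mono h2
  obtain ⟨c, hc⟩ := exists_linearIndependent_of_le_finrank
    (R := ℝ) (M := LinearMap.ker Ψ) (n := 2) (by omega)
  refine ⟨fun j => c j, hc.map' (LinearMap.ker Ψ).subtype (Submodule.ker_subtype _), fun j => ?_⟩
  exact (Fintype.linearCombination_apply ℝ _ _).symm.trans (LinearMap.mem_ker.1 (c j).2)

/-- The isotropic plane in the row space of `φ [·, ·]`, put in echelon form, gives the chart `p, q`
and the coordinates `x`. Its kernel contains the radical, so the endpoint is a combination of kernel
vectors and their brackets. -/
theorem IsAbnormal.exists_kernelVec (e : Module.Basis (Fin r) ℝ V₁) {u : Control h} (hu : IsAbnormal h u)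
    {c : Fin 2 → IncPairs (Fin r) → ℝ}
    (hc : ∀ j, ∑ x, c j x • ⁅(e x.1.1 : 𝔤), (e x.1.2 : 𝔤)⁆ = 0) :
    ∃ (p q : Fin r) (_ : p ≠ q) (x : Rest p q ⊕ Rest p q → ℝ)
      (s : Rest p q → ℝ) (t : IncPairs (Rest p q) → ℝ),
      (∀ j, skewForm (c j) (affinePoint (Pi.single p 1) (restVec p q) (x ∘ Sum.inl))
        (affinePoint (Pi.single q 1) (restVec p q) (x ∘ Sum.inr)) = 0) ∧
      endpoint h u = exp h (∑ j, s j • kernelVec (fun i => (e i : 𝔤)) x j +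
        ∑ y, t y • ⁅kernelVec (fun i => (e i : 𝔤)) x y.1.1,
          kernelVec (fun i => (e i : 𝔤)) x y.1.2⁆) := by
  obtain ⟨φ, hφ0, hφ1, hφ⟩ := hu.exists_covector
  set Ω : Fin r → Fin r → ℝ := fun i j => φ ⁅(e i : 𝔤), (e j : 𝔤)⁆ with hΩ
  have hspan : V₁ ≤ Submodule.span ℝ (range fun i => (e i : 𝔤)) := by
    intro v hv
    rw [Submodule.mem_span_range_iff_exists_fun]
    exact ⟨_, sum_repr_coe e hv⟩
  have hΩsk : ∀ i j, Ω i j = -Ω j i := fun i j => by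
    simp only [hΩ]
    rw [← lie_skew, map_neg]
  have hΩne : Ω ≠ 0 := by
    intro h0
    refine hφ0 (LinearMap.ext fun v => ?_)
    obtain ⟨x, hx, y, hy, rfl⟩ := h.exists_add v
    rw [← h.generates] at hy
    obtain ⟨d, rfl⟩ := exists_sum_of_mem_bracketSpan _ hspan hy
    rw [map_add, hφ1 x hx, map_sum, zero_add]
    refine Finset.sum_eq_zero fun z _ => ?_
    have := congrFun (congrFun h0 z.1.1) z.1.2
    simp only [hΩ, Pi.zero_apply] at this
    rw [map_smul, this, smul_zero]
  -- When `Ω = κ a ∧ b`, applying `φ` to the relation `c j` gives `κ * w j a b = 0`.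
  obtain ⟨a₀, ha₀, b₀, hb₀, hab₀, p, q, hmin⟩ := exists_isotropic_rows hΩsk hΩne
    (w := fun j => skewForm (c j)) (by
      intro κ a b hab j
      have h1 := congrArg φ (hc j)
      rw [map_sum, map_zero] at h1
      rw [skewForm_apply, Finset.mul_sum, ← h1]
      refine Finset.sum_congr rfl fun x _ => ?_
      have h2 := hab x.1.1 x.1.2
      simp only [hΩ] at h2
      rw [map_smul, h2, smul_eq_mul]
      ring)
  obtain ⟨a, ha, b, hb, hab, hap, haq, hbp, hbq⟩ := exists_echelon _
    (fun j => skewForm_isAlt (c j)) ha₀ hb₀ hab₀ hmin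
  have hpq : p ≠ q := by
    rintro rfl
    exact one_ne_zero (hap.symm.trans haq)
  set x : Rest p q ⊕ Rest p q → ℝ := Sum.elim (fun j => a j) (fun j => b j) with hx
  have hrad : radical V₁ φ ≤ Submodule.span ℝ (range (kernelVec (fun i => (e i : 𝔤)) x)) := by
    rintro v ⟨hv, hvφ⟩
    set y : Fin r → ℝ := fun i => e.repr ⟨v, hv⟩ i with hy
    have hvy : ∑ i, y i • (e i : 𝔤) = v := sum_repr_coe e hv
    have hrow : ∀ f ∈ Submodule.span ℝ (range Ω), ∑ i, f i * y i = 0 := by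
      intro f hf
      induction hf using Submodule.span_induction with
      | mem f hf =>
        obtain ⟨i, rfl⟩ := hf
        have h1 := hvφ (e i) (e i).2
        rw [← lie_skew, map_neg, neg_eq_zero, ← hvy, lie_sum, map_sum] at h1
        rw [← h1]
        refine Finset.sum_congr rfl fun j _ => ?_
        rw [lie_smul, map_smul, smul_eq_mul, mul_comm]
      | zero => simp
      | add f g _ _ hf hg => simp [add_mul, Finset.sum_add_distrib, hf, hg]
      | smul s f _ hf => simp [mul_assoc, ← Finset.mul_sum, hf]
    rw [← hvy]
    exact mem_span_kernelVec hpq _ hap haq hbp hbq (hrow a ha) (hrow b hb)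
  obtain ⟨v, hv, z, hz, hend⟩ := endpoint_mem_of_primitive_mem hφ
  obtain ⟨s, rfl⟩ := (Submodule.mem_span_range_iff_exists_fun ℝ).1 (hrad hv)
  obtain ⟨t, rfl⟩ := exists_sum_of_mem_bracketSpan _ hrad hz
  refine ⟨p, q, hpq, x, s, t, ?_, hend⟩
  intro j
  have h1 : affinePoint (Pi.single p 1) (restVec p q) (x ∘ Sum.inl) = a :=
    affinePoint_restVec hpq (Or.inl ⟨rfl, rfl⟩) hap haq
  have h2 : affinePoint (Pi.single q 1) (restVec p q) (x ∘ Sum.inr) = b :=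
    affinePoint_restVec hpq (Or.inr ⟨rfl, rfl⟩) hbq hbp
  rw [h1, h2]
  exact hab j

theorem ratCov_abnormalSet (e : Module.Basis (Fin r) ℝ V₁)
    (hr : Fintype.card (IncPairs (Fin r)) = Module.finrank ℝ V₂ + 2)
    {n : ℕ} (b : Module.Basis (Fin n) ℝ (CarnotGroup h)) :
    RatCov (Fintype.card (IncPairs (Fin r)) + r - 5) (b.equivFun '' abnormalSet h) := by
  obtain ⟨c, hcli, hc⟩ := exists_relations e h hr
  have hind : ∀ s, pencil (fun j => skewForm (c j)) s = 0 → s = 0 := by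
    intro s hs
    rw [pencil_skewForm] at hs
    have h1 := Fintype.linearIndependent_iff.1 hcli s
      (by rw [Fin.sum_univ_two]; exact skewForm_eq_zero hs)
    exact funext h1
  -- For each chart, one free coefficient is added per kernel vector and one per increasing pair of
  -- them.
  have hpiece : ∀ pq : {pq : Fin r × Fin r // pq.1 ≠ pq.2}, _ := fun pq =>
    (ratCov_isotropic (Pi.single pq.1.1 1) (Pi.single pq.1.2 1) (restVec pq.1.1 pq.1.2)
      (fun j => skewForm_isAlt (c j)) span_restVec hind).polyImage
      (ρ := Rest pq.1.1 pq.1.2 ⊕ IncPairs (Rest pq.1.1 pq.1.2)) (μ := Fin n)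
      (F := fun m z => ∑ j, z (Sum.inr (Sum.inl j)) * (b.coord m ∘ₗ
          ((exp h : 𝔤 →L[ℝ] CarnotGroup h) : 𝔤 →ₗ[ℝ] CarnotGroup h))
            (kernelVec (fun i => (e i : 𝔤)) (z ∘ Sum.inl) j) +
        ∑ y, z (Sum.inr (Sum.inr y)) * (b.coord m ∘ₗ
          ((exp h : 𝔤 →L[ℝ] CarnotGroup h) : 𝔤 →ₗ[ℝ] CarnotGroup h))
            ⁅kernelVec (fun i => (e i : 𝔤)) (z ∘ Sum.inl) y.1.1,
              kernelVec (fun i => (e i : 𝔤)) (z ∘ Sum.inl) y.1.2⁆)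
      (fun m => (IsPolyFun.sum _ fun j => (IsPolyFun.coord _).mul
        (isPolyFun_kernelVec _ _ _ _)).add (IsPolyFun.sum _ fun y => (IsPolyFun.coord _).mul
          (isPolyFun_lie_kernelVec _ _ _ _ _)))
  have hdim : ∀ pq : {pq : Fin r × Fin r // pq.1 ≠ pq.2},
      Fintype.card (Rest pq.1.1 pq.1.2) + Fintype.card (Rest pq.1.1 pq.1.2) - 2 +
        Fintype.card (Rest pq.1.1 pq.1.2 ⊕ IncPairs (Rest pq.1.1 pq.1.2)) ≤
      Fintype.card (IncPairs (Fin r)) + r - 5 := by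
    intro pq
    have h1 := card_ne_and_ne pq.2
    have h2 := two_mul_card_incPairs_add (Rest pq.1.1 pq.1.2)
    have h3 := two_mul_card_incPairs_add (Fin r)
    rw [Fintype.card_fin] at h1 h3
    rw [Fintype.card_sum]
    set m := Fintype.card (Rest pq.1.1 pq.1.2) with hm
    have h4 : r * r = m * m + 4 * m + 4 := by
      have : ∀ a b : ℕ, a + 2 = b → b * b = a * a + 4 * a + 4 := by
        rintro a _ rfl
        ring
      exact this m r h1
    rw [h4] at h3
    -- For `m = 0` the natural subtractions truncate and both sides are zero.
    rcases Nat.eq_zero_or_pos m with h6 | h6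
    · rw [h6] at h2 h3
      omega
    · omega
  refine (RatCov.iUnion fun pq => (hpiece pq).mono (hdim pq)).subset ?_
  rintro _ ⟨_, ⟨u, hu, rfl⟩, rfl⟩
  obtain ⟨p, q, hpq, x, s, t, hx, hend⟩ := hu.exists_kernelVec h e hc
  refine mem_iUnion.2 ⟨⟨(p, q), hpq⟩, x, hx, Sum.elim s t, fun m => ?_⟩
  rw [hend, Module.Basis.equivFun_apply, ← Module.Basis.coord_apply]
  simp [Sum.elim_comp_inl]

end FiniteDimensional

end CarnotGroup

theorem theorem4p4 {𝔤 : Type*} [NormedLieRing 𝔤] [NormedRealLieAlgebra 𝔤]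
    [FiniteDimensional ℝ 𝔤] {V₁ V₂ : Submodule ℝ 𝔤} (h : IsStepTwoStratification V₁ V₂)
    (r : ℕ) (h₁ : Module.finrank ℝ V₁ = r)
    (h₂ : (Module.finrank ℝ V₂ : ℝ) = (r : ℝ) * (r - 1) / 2 - 2) :
    ∃ d : ℕ, (d : ℝ) = ((r : ℝ) ^ 2 + r) / 2 - 5 ∧
      d + 3 = Module.finrank ℝ (CarnotGroup h) ∧
      dimH (CarnotGroup.abnormalSet h) ≤ d ∧
      IsContainedInSubvariety (CarnotGroup.abnormalSet h) d := by
  have e : Module.Basis (Fin r) ℝ V₁ := Module.finBasisOfFinrankEq ℝ V₁ h₁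
  have hc := two_mul_card_incPairs_add (Fin r)
  rw [Fintype.card_fin] at hc
  have hr : Fintype.card (IncPairs (Fin r)) = Module.finrank ℝ V₂ + 2 := by
    have : (2 * Fintype.card (IncPairs (Fin r)) + r : ℝ) = r * r := by exact_mod_cast hc
    have h3 : (Fintype.card (IncPairs (Fin r)) : ℝ) = (Module.finrank ℝ V₂ + 2 : ℕ) := by
      push_cast
      rw [h₂]
      linarith
    exact_mod_cast h3
  have hpos : 0 < Module.finrank ℝ V₂ := Module.finrank_pos_iff.2
    (Submodule.nontrivial_iff_ne_bot.2 h.ne_bot)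
  -- Together with `hpos` this makes `- 5` a genuine subtraction in the natural numbers.
  have hr3 : 3 ≤ r := by
    by_contra! hlt
    interval_cases r <;> omega
  have hfin : Module.finrank ℝ (CarnotGroup h) = r + Module.finrank ℝ V₂ := by
    rw [← (CarnotGroup.exp h).toLinearEquiv.finrank_eq, ← h₁]
    exact (Submodule.finrank_add_eq_of_isCompl h.isCompl).symm
  have : FiniteDimensional ℝ (CarnotGroup h) :=
    (CarnotGroup.exp h).toLinearEquiv.finiteDimensional
  refine ⟨Fintype.card (IncPairs (Fin r)) + r - 5, ?_, by omega, ?_, fun n b =>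
    (CarnotGroup.ratCov_abnormalSet h e hr b).exists_ideal⟩
  · have h3 : (2 * Fintype.card (IncPairs (Fin r)) + r : ℝ) = r * r := by exact_mod_cast hc
    rw [Nat.cast_sub (by omega)]
    push_cast
    linarith
  · set b := Module.finBasis ℝ (CarnotGroup h)
    have h1 := (CarnotGroup.ratCov_abnormalSet h e hr b).dimH_le
    have h2 := b.equivFun.toContinuousLinearEquiv.dimH_image (CarnotGroup.abnormalSet h)
    rw [← h2]
    exact h1
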